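/- Let $\mathbb K(m)=\int_0^{\pi/2}(1-m\sin^2\theta)^{-1/2}\,d\theta$ be the complete elliptic integral of the first kind (principal branch), and let $$\psi(\omega)=e^{-\pi\,\mathbb K(1-\omega)/\mathbb K(\omega)},\qquad \omega\in\mathbb C\setminus[1,\infty),$$ be the elliptic nome, with $\psi(0)=0$. (At $0$ the singularity is removable. For $\omega<0$ either boundary value of $\mathbb K$ on its cut gives the same value of $\psi$, so $\psi$ is analytic on $\mathbb C\setminus[1,\infty)$.) Let $$\psi_1(\omega)=\frac{1-\sqrt{1-\omega}}{1+\sqrt{1-\omega}}$$ (principal square root) be the conformal map of $\mathbb C\setminus[1,\infty)$ onto the unit disk, and for $k\ge1$ let $\psi_k(\omega)=[\psi_1(\omega^k)]^{1/k}$, with the branch of the $k$-th root that is analytic on $\{\omega:\omega^k\notin[1,\infty)\}$ and has positive derivative at $0$, that is, $\psi_k(\omega)=\omega\,(1+\sqrt{1-\omega^k})^{-2/k}$ with principal powers. Put $\Psi_n=\psi_{2^n}\circ\psi_{2^{n-1}}\circ\cdots\circ\psi_2\circ\psi_1$. Then $\Psi_n\to\psi$ as $n\to\infty$: 1. (First sheet.)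 $\Psi_n\to\psi$ locally uniformly on $\mathbb C\setminus[1,\infty)$. 2. (All sheets of the covering of $\hat{\mathbb C}\setminus\{0,1,\infty\}$ with fixed origin $0$, whose points are the homotopy classes of curves issuing from $0$.) Let $\gamma:[0,1]\to\mathbb C$ be continuous with $\gamma(0)=0$ and $\gamma(t)\notin\{0,1\}$ for $t>0$. Then the germs at $0$ of $\psi$ and of every $\Psi_n$ can be continued analytically along $\gamma$. Moreover, for every $t\in[0,1]$ there is a disk centered at $\gamma(t)$ on which the continuations of $\psi$ and of all $\Psi_n$ up to time $t$ are analytic, and on which those of $\Psi_n$ converge uniformly to that of $\psi$. -/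

import Mathlib

namespace NomeComposition

noncomputable section

/-- Principal branch of the complex square root (cut along the negative real axis). -/
def csqrt (x : ℂ) : ℂ := x ^ (1 / 2 : ℂ)

/-- The one-cut plane `ℂ \ [1, ∞)`. -/
def oneCutPlane : Set ℂ := {ω | ¬ (ω.im = 0 ∧ 1 ≤ ω.re)}

/-- The conformal map `ψ₁` of the one-cut plane onto the unit disk. -/
def psiOne (ω : ℂ) : ℂ := (1 - csqrt (1 - ω)) / (1 + csqrt (1 - ω))

/-- The map `ψ_k(ω) = [ψ₁(ω^k)]^{1/k}`, `k ≥ 1`, with the branch of the `k`-th root that is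
analytic on the plane with the `k` radial cuts `ω^k ∈ [1, ∞)` and has positive derivative at `0`.
Since `ψ₁(u) = u / (1 + √(1 - u))²` and `1 + √(1 - u)` has positive real part, this branch is
`ω · (1 + √(1 - ω^k))^{-2/k}` with principal powers; see `psi_pow`, `psi_differentiableOn` and
`psi_hasDerivAt_zero`. -/
def psi (k : ℕ) (ω : ℂ) : ℂ := ω * (1 + csqrt (1 - ω ^ k)) ^ (-(2 : ℂ) / (k : ℂ))

theorem csqrt_sq (x : ℂ) : csqrt x ^ 2 = x := by
  unfold csqrt
  rw [← Complex.cpow_nat_mul]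
  norm_num

theorem csqrt_re_nonneg (x : ℂ) : 0 ≤ (csqrt x).re := by
  unfold csqrt
  by_cases hx : x = 0
  · subst hx; norm_num
  rw [Complex.cpow_def_of_ne_zero hx, Complex.exp_re]
  have h1 : (Complex.log x * (1 / 2)).im = x.arg / 2 := by
    have : (Complex.log x * (1 / 2 : ℂ)) = Complex.log x / ((2 : ℝ) : ℂ) := by
      push_cast; ring
    rw [this, Complex.div_ofReal_im, Complex.log_im]
  rw [h1]
  refine mul_nonneg (Real.exp_pos _).le (Real.cos_nonneg_of_mem_Icc ⟨?_, ?_⟩)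
  · linarith [Complex.neg_pi_lt_arg x]
  · linarith [Complex.arg_le_pi x]

theorem one_add_csqrt_re_pos (x : ℂ) : 0 < (1 + csqrt x).re := by
  have := csqrt_re_nonneg x
  rw [Complex.add_re, Complex.one_re]; linarith

theorem one_add_csqrt_ne_zero (x : ℂ) : 1 + csqrt x ≠ 0 := fun h => by
  have := one_add_csqrt_re_pos x
  rw [h] at this
  simp at this

theorem psi_pow (k : ℕ) (hk : k ≠ 0) (ω : ℂ) : psi k ω ^ k = psiOne (ω ^ k) := by
  have hne := one_add_csqrt_ne_zero (1 - ω ^ k)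
  have hk' : (k : ℂ) ≠ 0 := by exact_mod_cast hk
  have hsq := csqrt_sq (1 - ω ^ k)
  unfold psi psiOne
  rw [mul_pow, ← Complex.cpow_nat_mul, mul_div_cancel₀ _ hk', Complex.cpow_neg,
    Complex.cpow_ofNat, ← div_eq_mul_inv, div_eq_div_iff (pow_ne_zero 2 hne) hne]
  linear_combination (1 + csqrt (1 - ω ^ k)) * hsq

theorem psi_one (ω : ℂ) : psi 1 ω = psiOne ω := by
  simpa using psi_pow 1 one_ne_zero ω

theorem psi_differentiableOn (k : ℕ) :
    DifferentiableOn ℂ (psi k) {ω | ω ^ k ∈ oneCutPlane} := by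
  intro ω hω
  have hs : 1 - ω ^ k ∈ Complex.slitPlane := by
    rw [Complex.mem_slitPlane_iff]
    by_contra! h
    refine hω ⟨?_, ?_⟩
    · have := h.2; simp at this; simpa using this
    · have := h.1; simp at this; linarith
  refine DifferentiableAt.differentiableWithinAt ?_
  unfold psi csqrt
  have h2 : 1 + (1 - ω ^ k) ^ (1 / 2 : ℂ) ∈ Complex.slitPlane :=
    Or.inl (one_add_csqrt_re_pos (1 - ω ^ k))
  refine differentiableAt_id.mul (DifferentiableAt.cpow_const ?_ h2)
  have h3 : DifferentiableAt ℂ (fun ω : ℂ => 1 - ω ^ k) ω := by fun_prop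
  exact (h3.cpow_const hs).const_add _

theorem psi_hasDerivAt_zero (k : ℕ) (hk : k ≠ 0) :
    HasDerivAt (psi k) (((4 : ℝ) ^ (-1 / (k : ℝ)) : ℝ) : ℂ) 0 := by
  have hg : DifferentiableAt ℂ
      (fun ω : ℂ => (1 + csqrt (1 - ω ^ k)) ^ (-(2 : ℂ) / (k : ℂ))) 0 := by
    unfold csqrt
    refine DifferentiableAt.cpow_const
      ((DifferentiableAt.cpow_const (by fun_prop) ?_).const_add _) ?_
    · simp [hk]
    · exact Or.inl (one_add_csqrt_re_pos (1 - (0 : ℂ) ^ k))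
  have h := (hasDerivAt_id (0 : ℂ)).mul hg.hasDerivAt
  refine h.congr_deriv ?_
  have h1 : csqrt 1 = 1 := by simp [csqrt]
  simp only [id, zero_mul, add_zero, one_mul, zero_pow hk, sub_zero, h1]
  have e : (1 + 1 : ℂ) = ((2 : ℝ) : ℂ) := by norm_num
  have e2 : (-(2 : ℂ) / (k : ℂ)) = ((-2 / (k : ℝ) : ℝ) : ℂ) := by push_cast; ring
  rw [e, e2, ← Complex.ofReal_cpow (by norm_num)]
  congr 1
  rw [show (4 : ℝ) = 2 ^ (2 : ℝ) by norm_num, ← Real.rpow_mul (by norm_num)]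
  congr 1; ring

/-- The composition `ψ_{2^n} ∘ ψ_{2^{n-1}} ∘ ⋯ ∘ ψ₂ ∘ ψ₁`. -/
def psiComp : ℕ → ℂ → ℂ
  | 0 => psiOne
  | n + 1 => psi (2 ^ (n + 1)) ∘ psiComp n

/-- The complete elliptic integral of the first kind, as a function of the parameter `m = k²`,
`K(m) = ∫_0^{π/2} (1 - m sin² θ)^{-1/2} dθ = (π/2) ₂F₁(1/2, 1/2; 1; m)`, principal branch. -/
def ellK (m : ℂ) : ℂ :=
  ∫ θ in (0 : ℝ)..(Real.pi / 2), (1 - m * ((Real.sin θ : ℝ) : ℂ) ^ 2) ^ (-(1 / 2) : ℂ)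

/-- The elliptic nome `q(ω) = exp(-π K(1-ω)/K(ω))` on the first sheet `ℂ \ [1, ∞)`, where `0` is
a removable singularity with value `0`. For `ω < 0` the principal power in `ellK (1 - ω)` selects
one of the two boundary values of `K` on its cut; they differ by `±2i K(ω)`, so `q(ω)` does not
depend on the choice. -/
def nome (ω : ℂ) : ℂ :=
  open Classical in
  if ω = 0 then 0 else Complex.exp (-(Real.pi : ℂ) * ellK (1 - ω) / ellK ω)

/-- `F` is an analytic continuation along the curve `γ` of the germ of `f` at `γ 0`: `F t` is
(a representative of) an analytic germ at `γ t`, and for `s` near `t` the germ at `γ s` is the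
one induced by `F t`. -/
structure IsContinuationAlong (γ : C(unitInterval, ℂ)) (f : ℂ → ℂ)
    (F : unitInterval → ℂ → ℂ) : Prop where
  start : F 0 =ᶠ[nhds (γ 0)] f
  analyticAt : ∀ t, AnalyticAt ℂ (F t) (γ t)
  coherent : ∀ t, ∀ᶠ s in nhds t, F s =ᶠ[nhds (γ s)] F t

/-- A curve that starts at `0` and afterwards avoids `0` and `1`. The homotopy classes of these
curves are the points, other than the origin, of the covering of `Ĉ \ {0, 1, ∞}` with fixed
origin `0`. -/
def IsCurveFromOrigin (γ : C(unitInterval, ℂ)) : Prop :=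
  γ 0 = 0 ∧ ∀ t, t ≠ 0 → γ t ≠ 0 ∧ γ t ≠ 1

end

end NomeComposition

/-!
Since `ψ_{2k}(ω)² = ψ_k(ω²)`, one has `Ψ_{n+1}² = Ψ_n ∘ ψ₁²`, so the uniform limit `L` of the `Ψ_n`
satisfies `L ∘ ψ₁² = L²`. By the Landen transformation the nome satisfies the same equation, so on
`(0, 1)` both `-log L` and `-log` of the nome double under `ω ↦ ψ₁(ω)²`, while they differ from
`-log ω` by a bounded amount. Hence they are equal on `(0, 1)`, and by the identity theorem `L` is
the nome on the one-cut plane.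

On the other sheets, `Ψ_n = q exp (e(q^(2^n)) / 2^n)` near `0`, where `q` is the nome and `e` is a
logarithm of `ψ₁ / q` as a function of `q`; the functional equation extends `e` from a disk of
radius `ρ²` to the disk of radius `ρ`, hence to the unit disk. It remains to continue `q` inside the
unit disk: passing around `0` adds an imaginary constant to `u = -log q`, and `ω ↦ 1 - ω` replaces
`u` by `π² / u`, so every continuation of `q` is a holomorphic map from the right half-plane to the
unit disk applied to a branch of `u`.
-/

namespace NomeComposition

open Filter Topology MeasureTheory

noncomputable section

/-! ### The maps `ψ_k`, their compositions and the limit of the compositions -/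

theorem mem_oneCutPlane_iff {ω : ℂ} : ω ∈ oneCutPlane ↔ 1 - ω ∈ Complex.slitPlane := by
  simp only [oneCutPlane, Set.mem_ofPred_eq, Complex.mem_slitPlane_iff, Complex.sub_re,
    Complex.one_re, Complex.sub_im, Complex.one_im, zero_sub, neg_ne_zero, sub_pos]
  rw [not_and_or, not_le, or_comm]

theorem isOpen_oneCutPlane : IsOpen oneCutPlane := by
  have : oneCutPlane = (fun ω : ℂ => 1 - ω) ⁻¹' Complex.slitPlane :=
    Set.ext fun _ => mem_oneCutPlane_iff
  rw [this]
  exact Complex.isOpen_slitPlane.preimage (by fun_prop)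

theorem mem_oneCutPlane_of_norm_lt_one {ω : ℂ} (h : ‖ω‖ < 1) : ω ∈ oneCutPlane :=
  fun hω => (hω.2.trans (Complex.re_le_norm ω)).not_gt h

theorem pow_mem_oneCutPlane {ω : ℂ} (h : ‖ω‖ < 1) {k : ℕ} (hk : k ≠ 0) :
    ω ^ k ∈ oneCutPlane :=
  mem_oneCutPlane_of_norm_lt_one ((norm_pow ω k).trans_lt (pow_lt_one₀ (norm_nonneg ω) h hk))

theorem ofReal_mem_oneCutPlane {x : ℝ} (h : x < 1) : (x : ℂ) ∈ oneCutPlane :=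
  fun hx => h.not_ge hx.2

theorem csqrt_re_pos {x : ℂ} (hx : x ∈ Complex.slitPlane) : 0 < (csqrt x).re := by
  refine (csqrt_re_nonneg x).lt_of_ne' fun hre => ?_
  have hx' : x = ((-(csqrt x).im ^ 2 : ℝ) : ℂ) := by
    refine (csqrt_sq x).symm.trans (Complex.ext ?_ ?_) <;> simp [sq, hre]
  rw [hx', Complex.ofReal_mem_slitPlane] at hx
  linarith [sq_nonneg (csqrt x).im]

theorem norm_csqrt (x : ℂ) : ‖csqrt x‖ = √‖x‖ := by
  rw [eq_comm, Real.sqrt_eq_iff_eq_sq (norm_nonneg _) (norm_nonneg _), ← norm_pow, csqrt_sq]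

theorem csqrt_ofReal {x : ℝ} (hx : 0 ≤ x) : csqrt x = (√x : ℝ) := by
  rw [csqrt, Real.sqrt_eq_rpow, Complex.ofReal_cpow hx]
  norm_num

theorem one_le_norm_one_add_csqrt (x : ℂ) : 1 ≤ ‖1 + csqrt x‖ := by
  refine le_trans ?_ (Complex.re_le_norm _)
  rw [Complex.add_re, Complex.one_re]
  linarith [csqrt_re_nonneg x]

theorem norm_one_add_csqrt_one_sub_le {u : ℂ} (hu : ‖u‖ ≤ 1) : ‖1 + csqrt (1 - u)‖ ≤ 3 := by
  have h : ‖1 - u‖ ≤ 2 ^ 2 := by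
    calc ‖1 - u‖ ≤ ‖(1 : ℂ)‖ + ‖u‖ := norm_sub_le _ _
      _ ≤ 2 ^ 2 := by rw [norm_one]; linarith
  calc ‖1 + csqrt (1 - u)‖ ≤ ‖(1 : ℂ)‖ + ‖csqrt (1 - u)‖ := norm_add_le _ _
    _ ≤ 1 + 2 := by
      rw [norm_one, norm_csqrt]
      exact add_le_add_right ((Real.sqrt_le_left zero_le_two).2 h) 1
    _ = 3 := by norm_num

theorem norm_log_one_add_csqrt_one_sub_le {u : ℂ} (hu : ‖u‖ ≤ 1) :
    ‖Complex.log (1 + csqrt (1 - u))‖ ≤ 6 := by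
  set z := 1 + csqrt (1 - u)
  have h1 : 1 ≤ ‖z‖ := one_le_norm_one_add_csqrt _
  have h3 : ‖z‖ ≤ 3 := norm_one_add_csqrt_one_sub_le hu
  calc ‖Complex.log z‖ ≤ |(Complex.log z).re| + |(Complex.log z).im| :=
        Complex.norm_le_abs_re_add_abs_im _
    _ = Real.log ‖z‖ + |z.arg| := by
        rw [Complex.log_re, Complex.log_im, abs_of_nonneg (Real.log_nonneg h1)]
    _ ≤ 2 + Real.pi :=
        add_le_add (by linarith [Real.log_le_sub_one_of_pos (zero_lt_one.trans_le h1)])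
          (Complex.abs_arg_le_pi z)
    _ ≤ 6 := by linarith [Real.pi_lt_four]

theorem norm_exp_sub_one_le_of_re_nonpos {z : ℂ} (hz : z.re ≤ 0) :
    ‖Complex.exp z - 1‖ ≤ ‖z‖ := by
  have h := (convex_halfSpace_re_le 0).norm_image_sub_le_of_norm_hasDerivWithin_le
    (fun w _ => (Complex.hasDerivAt_exp w).hasDerivWithinAt)
    (fun w (hw : w.re ≤ 0) => by rw [Complex.norm_exp]; exact Real.exp_le_one_iff.2 hw)
    (Complex.zero_re.le : (0 : ℂ) ∈ {w : ℂ | w.re ≤ 0}) hz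
  simpa only [Complex.exp_zero, one_mul, sub_zero] using h

theorem psi_eq_mul_exp (k : ℕ) (ω : ℂ) :
    psi k ω = ω * Complex.exp (-2 / k * Complex.log (1 + csqrt (1 - ω ^ k))) := by
  rw [psi, Complex.cpow_def_of_ne_zero (one_add_csqrt_ne_zero _), mul_comm (Complex.log _)]

theorem norm_psi (k : ℕ) (ω : ℂ) :
    ‖psi k ω‖ = ‖ω‖ * ‖1 + csqrt (1 - ω ^ k)‖ ^ (-2 / k : ℝ) := by
  have hk : (-2 / k : ℂ) = ((-2 / k : ℝ) : ℂ) := by push_cast; ring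
  rw [psi, norm_mul, hk, Complex.norm_cpow_real]

theorem neg_two_div_natCast_nonpos (k : ℕ) : (-2 / k : ℝ) ≤ 0 :=
  div_nonpos_of_nonpos_of_nonneg (by norm_num) k.cast_nonneg

theorem norm_psi_le (k : ℕ) (ω : ℂ) : ‖psi k ω‖ ≤ ‖ω‖ := by
  rw [norm_psi]
  exact mul_le_of_le_one_right (norm_nonneg _) (Real.rpow_le_one_of_one_le_of_nonpos
    (one_le_norm_one_add_csqrt _) (neg_two_div_natCast_nonpos k))

theorem le_norm_psi (k : ℕ) {ω : ℂ} (hω : ‖ω‖ ≤ 1) :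
    ‖ω‖ * (3 : ℝ) ^ (-2 / k : ℝ) ≤ ‖psi k ω‖ := by
  have hpow : ‖ω ^ k‖ ≤ 1 := (norm_pow ω k).trans_le (pow_le_one₀ (norm_nonneg _) hω)
  rw [norm_psi]
  exact mul_le_mul_of_nonneg_left (Real.rpow_le_rpow_of_nonpos
    (zero_lt_one.trans_le (one_le_norm_one_add_csqrt _)) (norm_one_add_csqrt_one_sub_le hpow)
    (neg_two_div_natCast_nonpos k)) (norm_nonneg _)

theorem norm_psi_sub_le (k : ℕ) {ω : ℂ} (hω : ‖ω‖ ≤ 1) : ‖psi k ω - ω‖ ≤ 12 / k := by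
  have hpow : ‖ω ^ k‖ ≤ 1 := (norm_pow ω k).trans_le (pow_le_one₀ (norm_nonneg _) hω)
  set L := Complex.log (1 + csqrt (1 - ω ^ k)) with hL
  have hscale : (-2 / k : ℂ) * L = ((-2 / k : ℝ) : ℂ) * L := by push_cast; rfl
  have hre : (-2 / k * L : ℂ).re ≤ 0 := by
    rw [hscale, Complex.re_ofReal_mul, hL, Complex.log_re]
    exact mul_nonpos_of_nonpos_of_nonneg (neg_two_div_natCast_nonpos k)
      (Real.log_nonneg (one_le_norm_one_add_csqrt _))
  calc ‖psi k ω - ω‖ = ‖ω‖ * ‖Complex.exp (-2 / k * L) - 1‖ := by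
        rw [psi_eq_mul_exp, ← norm_mul, mul_sub_one]
    _ ≤ 1 * ‖(-2 / k * L : ℂ)‖ :=
        mul_le_mul hω (norm_exp_sub_one_le_of_re_nonpos hre) (norm_nonneg _) zero_le_one
    _ = 2 / k * ‖L‖ := by
        rw [one_mul, norm_mul, norm_div, norm_neg, Complex.norm_natCast, Complex.norm_ofNat]
    _ ≤ 2 / k * 6 := by gcongr; exact norm_log_one_add_csqrt_one_sub_le hpow
    _ = 12 / k := by ring

theorem psi_two_mul_sq {k : ℕ} (hk : k ≠ 0) (ω : ℂ) : psi (2 * k) ω ^ 2 = psi k (ω ^ 2) := by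
  have hk' : (k : ℂ) ≠ 0 := Nat.cast_ne_zero.2 hk
  have hexp : ((2 : ℕ) : ℂ) * (-2 / (2 * k : ℕ)) = -2 / k := by push_cast; field_simp
  rw [psi, psi, mul_pow, ← Complex.cpow_nat_mul, hexp, ← pow_mul]

theorem psi_ofReal_eq_norm (k : ℕ) {x : ℝ} (h0 : 0 ≤ x) (h1 : x ≤ 1) :
    psi k x = (‖psi k x‖ : ℝ) := by
  obtain ⟨y, hy0, hy⟩ : ∃ y : ℝ, 0 ≤ y ∧ psi k x = y := by
    refine ⟨x * (1 + √(1 - x ^ k)) ^ (-2 / k : ℝ), by positivity, ?_⟩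
    rw [psi, ← Complex.ofReal_pow, ← Complex.ofReal_one, ← Complex.ofReal_sub,
      csqrt_ofReal (sub_nonneg.2 (pow_le_one₀ h0 h1)), Complex.ofReal_mul,
      Complex.ofReal_cpow (by positivity)]
    push_cast
    rfl
  rw [hy, Complex.norm_of_nonneg hy0]

theorem norm_one_sub_lt_norm_one_add {z : ℂ} (hz : 0 < z.re) : ‖1 - z‖ < ‖1 + z‖ := by
  rw [← sq_lt_sq₀ (norm_nonneg _) (norm_nonneg _), Complex.sq_norm, Complex.sq_norm,
    Complex.normSq_apply, Complex.normSq_apply]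
  simp only [Complex.sub_re, Complex.add_re, Complex.sub_im, Complex.add_im, Complex.one_re,
    Complex.one_im]
  linarith

theorem norm_psiOne_lt_one {ω : ℂ} (h : ω ∈ oneCutPlane) : ‖psiOne ω‖ < 1 := by
  rw [psiOne, norm_div, div_lt_one (norm_pos_iff.2 (one_add_csqrt_ne_zero _))]
  exact norm_one_sub_lt_norm_one_add (csqrt_re_pos (mem_oneCutPlane_iff.1 h))

theorem norm_psiOne_le (ω : ℂ) : ‖psiOne ω‖ ≤ ‖ω‖ := by
  rw [← psi_one]
  exact norm_psi_le 1 ω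

theorem le_norm_psiOne {ω : ℂ} (hω : ‖ω‖ ≤ 1) : ‖ω‖ / 9 ≤ ‖psiOne ω‖ := by
  have h := le_norm_psi 1 hω
  have h9 : (3 : ℝ) ^ (-2 / (1 : ℕ) : ℝ) = 9⁻¹ := by
    rw [Nat.cast_one, div_one, Real.rpow_neg (by norm_num)]
    norm_num
  rwa [h9, psi_one] at h

theorem psiOne_ne_zero {ω : ℂ} (h : ω ≠ 0) : psiOne ω ≠ 0 := by
  rw [← psi_one, psi_eq_mul_exp]
  exact mul_ne_zero h (Complex.exp_ne_zero _)

theorem psiOne_zero : psiOne 0 = 0 :=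
  norm_le_zero_iff.1 ((norm_psiOne_le 0).trans_eq norm_zero)

theorem psiOne_differentiableOn : DifferentiableOn ℂ psiOne oneCutPlane := by
  have h := psi_differentiableOn 1
  simp only [pow_one] at h
  exact h.congr fun ω _ => (psi_one ω).symm

theorem norm_psiComp_le (n : ℕ) (ω : ℂ) : ‖psiComp n ω‖ ≤ ‖psiOne ω‖ := by
  induction n with
  | zero => exact le_rfl
  | succ n ih => exact (norm_psi_le _ _).trans ih

theorem norm_psiComp_lt_one (n : ℕ) {ω : ℂ} (h : ω ∈ oneCutPlane) : ‖psiComp n ω‖ < 1 :=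
  (norm_psiComp_le n ω).trans_lt (norm_psiOne_lt_one h)

theorem le_norm_psiComp (n : ℕ) {ω : ℂ} (h : ω ∈ oneCutPlane) :
    ‖psiOne ω‖ * (3 : ℝ) ^ (-2 * (1 - 1 / 2 ^ n) : ℝ) ≤ ‖psiComp n ω‖ := by
  induction n with
  | zero => simp [psiComp]
  | succ n ih =>
    have hexp : (-2 * (1 - 1 / 2 ^ (n + 1)) : ℝ) =
        -2 * (1 - 1 / 2 ^ n) + -2 / (2 ^ (n + 1) : ℕ) := by
      push_cast
      field_simp
      ring
    rw [hexp, Real.rpow_add (by norm_num), ← mul_assoc]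
    exact (mul_le_mul_of_nonneg_right ih (by positivity)).trans
      (le_norm_psi (2 ^ (n + 1)) (norm_psiComp_lt_one n h).le)

theorem psiComp_differentiableOn (n : ℕ) : DifferentiableOn ℂ (psiComp n) oneCutPlane := by
  induction n with
  | zero => exact psiOne_differentiableOn
  | succ n ih =>
    exact (psi_differentiableOn _).comp ih fun ω h =>
      pow_mem_oneCutPlane (norm_psiComp_lt_one n h) (by positivity)

theorem psiComp_succ_sq (n : ℕ) (ω : ℂ) : psiComp (n + 1) ω ^ 2 = psiComp n (psiOne ω ^ 2) := by
  induction n with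
  | zero => exact (psi_two_mul_sq one_ne_zero (psiOne ω)).trans (psi_one _)
  | succ n ih =>
    calc psiComp (n + 2) ω ^ 2 = psi (2 ^ (n + 1)) (psiComp (n + 1) ω ^ 2) := by
          rw [← psi_two_mul_sq (by positivity), ← pow_succ']
          rfl
      _ = psiComp (n + 1) (psiOne ω ^ 2) := by rw [ih]; rfl

theorem psiComp_ofReal_eq_norm (n : ℕ) {x : ℝ} (h0 : 0 ≤ x) (h1 : x < 1) :
    psiComp n x = (‖psiComp n x‖ : ℝ) := by
  induction n with
  | zero =>
    have h := psi_ofReal_eq_norm 1 h0 h1.le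
    rwa [psi_one] at h
  | succ n ih =>
    have h := psi_ofReal_eq_norm (2 ^ (n + 1)) (norm_nonneg (psiComp n x))
      (norm_psiComp_lt_one n (ofReal_mem_oneCutPlane h1)).le
    rwa [← ih] at h

/-- The limit of the compositions `Ψ_n` on the one-cut plane, as a telescoping series. -/
def psiLim (ω : ℂ) : ℂ := psiOne ω + ∑' n, (psiComp (n + 1) ω - psiComp n ω)

theorem tendstoUniformlyOn_psiComp :
    TendstoUniformlyOn psiComp psiLim atTop oneCutPlane := by
  have hsum : Summable fun n : ℕ => (12 : ℝ) / (2 ^ (n + 1) : ℕ) := by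
    refine (summable_geometric_two.mul_left (6 : ℝ)).congr fun n => ?_
    push_cast
    rw [pow_succ, one_div_pow]
    field_simp
    norm_num
  have h := tendstoUniformlyOn_tsum_nat (f := fun n ω => psiComp (n + 1) ω - psiComp n ω) hsum
    (s := oneCutPlane) fun n ω hω => norm_psi_sub_le (2 ^ (n + 1)) (norm_psiComp_lt_one n hω).le
  rw [Metric.tendstoUniformlyOn_iff] at h ⊢
  refine fun ε hε => (h ε hε).mono fun n hn ω hω => ?_
  have hn := hn ω hω
  rw [Finset.sum_range_sub fun n => psiComp n ω, ← dist_add_left (psiOne ω)] at hn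
  exact (congrArg (dist (psiLim ω)) (add_sub_cancel (psiOne ω) _).symm).trans_lt hn

theorem tendsto_psiComp {ω : ℂ} (h : ω ∈ oneCutPlane) :
    Tendsto (fun n => psiComp n ω) atTop (𝓝 (psiLim ω)) :=
  tendstoUniformlyOn_psiComp.tendsto_at h

theorem psiLim_differentiableOn : DifferentiableOn ℂ psiLim oneCutPlane :=
  tendstoUniformlyOn_psiComp.tendstoLocallyUniformlyOn.differentiableOn
    (Eventually.of_forall psiComp_differentiableOn) isOpen_oneCutPlane

theorem norm_psiLim_le {ω : ℂ} (h : ω ∈ oneCutPlane) : ‖psiLim ω‖ ≤ ‖psiOne ω‖ :=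
  le_of_tendsto' (tendsto_psiComp h).norm fun n => norm_psiComp_le n ω

theorem norm_psiLim_lt_one {ω : ℂ} (h : ω ∈ oneCutPlane) : ‖psiLim ω‖ < 1 :=
  (norm_psiLim_le h).trans_lt (norm_psiOne_lt_one h)

theorem le_norm_psiLim {ω : ℂ} (h : ω ∈ oneCutPlane) : ‖psiOne ω‖ / 9 ≤ ‖psiLim ω‖ := by
  have h9 : (9 : ℝ)⁻¹ = 3 ^ (-2 : ℝ) := by
    rw [Real.rpow_neg (by norm_num)]
    norm_num
  refine ge_of_tendsto' (tendsto_psiComp h).norm fun n => le_trans ?_ (le_norm_psiComp n h)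
  rw [div_eq_mul_inv, h9]
  gcongr
  · norm_num
  · linarith [show (0 : ℝ) ≤ 1 / 2 ^ n by positivity]

theorem psiLim_zero : psiLim 0 = 0 := by
  have h := norm_psiLim_le (mem_oneCutPlane_of_norm_lt_one (norm_zero.trans_lt zero_lt_one))
  rwa [psiOne_zero, norm_zero, norm_le_zero_iff] at h

theorem psiLim_ne_zero {ω : ℂ} (h : ω ∈ oneCutPlane) (h0 : ω ≠ 0) : psiLim ω ≠ 0 :=
  norm_pos_iff.1 ((div_pos (norm_pos_iff.2 (psiOne_ne_zero h0)) (by norm_num)).trans_le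
    (le_norm_psiLim h))

theorem psiLim_sq {ω : ℂ} (h : ω ∈ oneCutPlane) : psiLim ω ^ 2 = psiLim (psiOne ω ^ 2) := by
  have hsq := ((tendsto_psiComp h).comp (tendsto_add_atTop_nat 1)).pow 2
  have hmem := pow_mem_oneCutPlane (norm_psiOne_lt_one h) two_ne_zero
  exact tendsto_nhds_unique hsq ((tendsto_psiComp hmem).congr fun n => (psiComp_succ_sq n ω).symm)

theorem psiLim_ofReal_eq_norm {x : ℝ} (h0 : 0 ≤ x) (h1 : x < 1) :
    psiLim x = (‖psiLim x‖ : ℝ) := by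
  have h := tendsto_psiComp (ofReal_mem_oneCutPlane h1)
  exact tendsto_nhds_unique h (((Complex.continuous_ofReal.tendsto _).comp h.norm).congr
    fun n => (psiComp_ofReal_eq_norm n h0 h1).symm)

/-! ### Gauss's integral -/

/-- The integrand `1 / √(a² cos² θ + b² sin² θ)` of Gauss's integral. -/
def gaussIntegrand (a b θ : ℝ) : ℝ := (√(a ^ 2 * Real.cos θ ^ 2 + b ^ 2 * Real.sin θ ^ 2))⁻¹

/-- Gauss's integral `∫_0^{π/2} dθ / √(a² cos² θ + b² sin² θ)`, invariant under the
arithmetic-geometric mean step. It expresses `ellK` on the reals. -/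
def gaussIntegral (a b : ℝ) : ℝ := ∫ θ in (0 : ℝ)..(Real.pi / 2), gaussIntegrand a b θ

theorem cos_pos_of_mem_Ioo_zero_pi_div_two {θ : ℝ} (hθ : θ ∈ Set.Ioo 0 (Real.pi / 2)) :
    0 < Real.cos θ :=
  Real.cos_pos_of_mem_Ioo ⟨(neg_neg_of_pos Real.pi_div_two_pos).trans hθ.1, hθ.2⟩

theorem image_mul_tan {b : ℝ} (hb : 0 < b) :
    (fun θ => b * Real.tan θ) '' Set.Ioo 0 (Real.pi / 2) = Set.Ioi 0 := by
  ext x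
  simp only [Set.mem_image, Set.mem_Ioo, Set.mem_Ioi]
  constructor
  · rintro ⟨θ, hθ, rfl⟩
    exact mul_pos hb (Real.tan_pos_of_pos_of_lt_pi_div_two hθ.1 hθ.2)
  · intro hx
    refine ⟨Real.arctan (x / b), ⟨Real.arctan_pos.2 (div_pos hx hb),
      Real.arctan_lt_pi_div_two _⟩, ?_⟩
    rw [Real.tan_arctan, mul_div_cancel₀ _ hb.ne']

theorem injOn_mul_tan {b : ℝ} (hb : 0 < b) :
    Set.InjOn (fun θ => b * Real.tan θ) (Set.Ioo 0 (Real.pi / 2)) := by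
  have hsub : Set.Ioo 0 (Real.pi / 2) ⊆ Set.Ioo (-(Real.pi / 2)) (Real.pi / 2) :=
    Set.Ioo_subset_Ioo_left (neg_nonpos.2 Real.pi_div_two_pos.le)
  exact fun x hx y hy h => Real.injOn_tan (hsub hx) (hsub hy) (mul_left_cancel₀ hb.ne' h)

theorem gaussIntegrand_eq_mul_comp_mul_tan (a : ℝ) {b θ : ℝ} (hb : 0 < b)
    (hθ : θ ∈ Set.Ioo 0 (Real.pi / 2)) :
    gaussIntegrand a b θ = b * (1 / Real.cos θ ^ 2) *
      (√((a ^ 2 + (b * Real.tan θ) ^ 2) * (b ^ 2 + (b * Real.tan θ) ^ 2)))⁻¹ := by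
  have hcos := cos_pos_of_mem_Ioo_zero_pi_div_two hθ
  have hsec : b ^ 2 + (b * Real.tan θ) ^ 2 = b ^ 2 / Real.cos θ ^ 2 := by
    rw [← Real.inv_one_add_tan_sq hcos.ne', div_inv_eq_mul]
    ring
  have hradicand : (a ^ 2 + (b * Real.tan θ) ^ 2) * (b ^ 2 + (b * Real.tan θ) ^ 2) =
      (b * (1 / Real.cos θ ^ 2)) ^ 2 *
        (a ^ 2 * Real.cos θ ^ 2 + b ^ 2 * Real.sin θ ^ 2) := by
    rw [hsec, Real.tan_eq_sin_div_cos]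
    field_simp
  have hpos : 0 < b * (1 / Real.cos θ ^ 2) := by positivity
  rw [hradicand, Real.sqrt_mul (sq_nonneg _), Real.sqrt_sq hpos.le, mul_inv,
    mul_inv_cancel_left₀ hpos.ne', gaussIntegrand]

theorem gaussIntegral_eq_integral_Ioi (a : ℝ) {b : ℝ} (hb : 0 < b) :
    gaussIntegral a b = ∫ x in Set.Ioi (0 : ℝ), (√((a ^ 2 + x ^ 2) * (b ^ 2 + x ^ 2)))⁻¹ := by
  rw [gaussIntegral, intervalIntegral.integral_of_le Real.pi_div_two_pos.le,
    integral_Ioc_eq_integral_Ioo, ← image_mul_tan hb,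
    integral_image_eq_integral_abs_deriv_smul (f' := fun θ => b * (1 / Real.cos θ ^ 2))
      measurableSet_Ioo (fun θ hθ => ?_) (injOn_mul_tan hb)]
  · refine setIntegral_congr_fun measurableSet_Ioo fun θ hθ => ?_
    rw [abs_of_nonneg (by positivity), smul_eq_mul]
    exact gaussIntegrand_eq_mul_comp_mul_tan a hb hθ
  · exact ((Real.hasDerivAt_tan (cos_pos_of_mem_Ioo_zero_pi_div_two hθ).ne').const_mul
      b).hasDerivWithinAt

theorem image_half_sub_div {c : ℝ} (hc : 0 < c) :
    (fun x : ℝ => (x - c / x) / 2) '' Set.Ioi 0 = Set.univ := by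
  refine Set.eq_univ_of_forall fun y => ?_
  have hsq : 0 ≤ y ^ 2 + c := by positivity
  have habs : |y| < √(y ^ 2 + c) := Real.lt_sqrt_of_sq_lt (by rw [sq_abs]; linarith)
  have hpos : 0 < y + √(y ^ 2 + c) := by linarith [neg_abs_le y]
  refine ⟨y + √(y ^ 2 + c), hpos, ?_⟩
  have hne := hpos.ne'
  field_simp
  linear_combination Real.sq_sqrt hsq

theorem injOn_half_sub_div {c : ℝ} (hc : 0 < c) :
    Set.InjOn (fun x : ℝ => (x - c / x) / 2) (Set.Ioi 0) := by
  intro x (hx : 0 < x) y (hy : 0 < y) (h : (x - c / x) / 2 = (y - c / y) / 2)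
  have hfactor : (x - y) * (x * y + c) = 0 := by
    field_simp at h
    linear_combination h
  exact sub_eq_zero.1 ((mul_eq_zero.1 hfactor).resolve_right (by positivity))

theorem hasDerivAt_half_sub_div (c : ℝ) {x : ℝ} (hx : x ≠ 0) :
    HasDerivAt (fun x : ℝ => (x - c / x) / 2) ((1 + c / x ^ 2) / 2) x := by
  refine (((hasDerivAt_id x).sub ((hasDerivAt_inv hx).const_mul c)).div_const 2).congr_deriv ?_
  field_simp
  ring

theorem half_sub_div_substitution {a b x : ℝ} (ha : 0 < a) (hb : 0 < b) (hx : 0 < x) :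
    (1 + a * b / x ^ 2) / 2 * (√((((a + b) / 2) ^ 2 + ((x - a * b / x) / 2) ^ 2) *
      (√(a * b) ^ 2 + ((x - a * b / x) / 2) ^ 2)))⁻¹ =
      2 * (√((a ^ 2 + x ^ 2) * (b ^ 2 + x ^ 2)))⁻¹ := by
  have hradicand : (((a + b) / 2) ^ 2 + ((x - a * b / x) / 2) ^ 2) *
      (√(a * b) ^ 2 + ((x - a * b / x) / 2) ^ 2) =
      ((1 + a * b / x ^ 2) / 4) ^ 2 * ((a ^ 2 + x ^ 2) * (b ^ 2 + x ^ 2)) := by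
    rw [Real.sq_sqrt (by positivity)]
    field_simp
    ring
  have hpos : 0 < (1 + a * b / x ^ 2) / 4 := by positivity
  rw [hradicand, Real.sqrt_mul (sq_nonneg _), Real.sqrt_sq hpos.le, mul_inv, ← mul_assoc]
  congr 1
  field_simp
  norm_num

theorem gaussIntegral_agm {a b : ℝ} (ha : 0 < a) (hb : 0 < b) :
    gaussIntegral ((a + b) / 2) (√(a * b)) = gaussIntegral a b := by
  have hab : 0 < a * b := mul_pos ha hb
  rw [gaussIntegral_eq_integral_Ioi _ (Real.sqrt_pos.2 hab), gaussIntegral_eq_integral_Ioi _ hb]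
  set f : ℝ → ℝ := fun x => (√((((a + b) / 2) ^ 2 + x ^ 2) * (√(a * b) ^ 2 + x ^ 2)))⁻¹
  have heven : ∫ x, f x = 2 * ∫ x in Set.Ioi (0 : ℝ), f x := by
    rw [← integral_comp_abs]
    simp only [f, sq_abs]
  have hsubst : ∫ x, f x =
      2 * ∫ x in Set.Ioi (0 : ℝ), (√((a ^ 2 + x ^ 2) * (b ^ 2 + x ^ 2)))⁻¹ := by
    rw [← integral_const_mul, ← setIntegral_univ, ← image_half_sub_div hab,
      integral_image_eq_integral_abs_deriv_smul measurableSet_Ioi (fun x (hx : 0 < x) =>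
        (hasDerivAt_half_sub_div (a * b) hx.ne').hasDerivWithinAt) (injOn_half_sub_div hab)]
    refine setIntegral_congr_fun measurableSet_Ioi fun x (hx : 0 < x) => ?_
    rw [abs_of_nonneg (by positivity), smul_eq_mul]
    exact half_sub_div_substitution ha hb hx
  exact mul_left_cancel₀ two_ne_zero (heven.symm.trans hsubst)

theorem gaussIntegral_const_mul {c : ℝ} (hc : 0 ≤ c) (a b : ℝ) :
    gaussIntegral (c * a) (c * b) = c⁻¹ * gaussIntegral a b := by
  rw [gaussIntegral, gaussIntegral, ← intervalIntegral.integral_const_mul]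
  congr 1
  ext θ
  have hradicand : (c * a) ^ 2 * Real.cos θ ^ 2 + (c * b) ^ 2 * Real.sin θ ^ 2 =
      c ^ 2 * (a ^ 2 * Real.cos θ ^ 2 + b ^ 2 * Real.sin θ ^ 2) := by ring
  rw [gaussIntegrand, hradicand, Real.sqrt_mul (sq_nonneg c), Real.sqrt_sq hc, mul_inv,
    gaussIntegrand]

theorem gaussIntegral_comm (a b : ℝ) : gaussIntegral a b = gaussIntegral b a := by
  have h := intervalIntegral.integral_comp_sub_left (a := 0) (b := Real.pi / 2)
    (gaussIntegrand b a) (Real.pi / 2)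
  rw [sub_self, sub_zero] at h
  rw [gaussIntegral, gaussIntegral, ← h]
  congr 1
  ext θ
  rw [gaussIntegrand, gaussIntegrand, Real.cos_pi_div_two_sub, Real.sin_pi_div_two_sub, add_comm]

section Estimates

variable {a b : ℝ}

theorem gaussIntegrand_radicand_pos (ha : 0 < a) (hb : 0 < b) (θ : ℝ) :
    0 < a ^ 2 * Real.cos θ ^ 2 + b ^ 2 * Real.sin θ ^ 2 := by
  rcases eq_or_ne (Real.sin θ) 0 with hsin | hsin
  · rw [Real.cos_sq', hsin]
    positivity
  · positivity

theorem gaussIntegrand_pos (ha : 0 < a) (hb : 0 < b) (θ : ℝ) : 0 < gaussIntegrand a b θ :=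
  inv_pos.2 (Real.sqrt_pos.2 (gaussIntegrand_radicand_pos ha hb θ))

theorem gaussIntegrand_continuous (ha : 0 < a) (hb : 0 < b) : Continuous (gaussIntegrand a b) :=
  Continuous.inv₀ (by fun_prop) fun θ =>
    (Real.sqrt_pos.2 (gaussIntegrand_radicand_pos ha hb θ)).ne'

theorem gaussIntegrand_intervalIntegrable (ha : 0 < a) (hb : 0 < b) (s t : ℝ) :
    IntervalIntegrable (gaussIntegrand a b) volume s t :=
  (gaussIntegrand_continuous ha hb).intervalIntegrable s t

theorem gaussIntegral_pos (ha : 0 < a) (hb : 0 < b) : 0 < gaussIntegral a b :=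
  intervalIntegral.intervalIntegral_pos_of_pos (gaussIntegrand_intervalIntegrable ha hb _ _)
    (gaussIntegrand_pos ha hb) Real.pi_div_two_pos

theorem pi_div_two_le_gaussIntegral_one (hb : 0 < b) (hb1 : b ≤ 1) :
    Real.pi / 2 ≤ gaussIntegral 1 b := by
  calc Real.pi / 2 = ∫ _ in (0 : ℝ)..(Real.pi / 2), (1 : ℝ) := by
        rw [intervalIntegral.integral_const, sub_zero, smul_eq_mul, mul_one]
    _ ≤ gaussIntegral 1 b :=
        intervalIntegral.integral_mono_on Real.pi_div_two_pos.le
          intervalIntegrable_const (gaussIntegrand_intervalIntegrable one_pos hb _ _) fun θ _ => ?_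
  refine (one_le_inv₀ (Real.sqrt_pos.2 (gaussIntegrand_radicand_pos one_pos hb θ))).2
    (Real.sqrt_le_one.2 ?_)
  nlinarith [Real.sin_sq_add_cos_sq θ, sq_nonneg (Real.sin θ), pow_le_one₀ (n := 2) hb.le hb1]

theorem gaussIntegral_one_le_pi_div_two_mul_inv (hb : 0 < b) (hb1 : b ≤ 1) :
    gaussIntegral 1 b ≤ Real.pi / 2 * b⁻¹ := by
  calc gaussIntegral 1 b ≤ ∫ _ in (0 : ℝ)..(Real.pi / 2), b⁻¹ :=
        intervalIntegral.integral_mono_on Real.pi_div_two_pos.le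
          (gaussIntegrand_intervalIntegrable one_pos hb _ _) intervalIntegrable_const fun θ _ => ?_
    _ = Real.pi / 2 * b⁻¹ := by
        rw [intervalIntegral.integral_const, sub_zero, smul_eq_mul]
  refine inv_anti₀ hb (Real.le_sqrt_of_sq_le ?_)
  nlinarith [Real.sin_sq_add_cos_sq θ, sq_nonneg (Real.cos θ), pow_le_one₀ (n := 2) hb.le hb1]

variable {k : ℝ}

theorem hasDerivAt_arsinh_div (hk : 0 < k) (x : ℝ) :
    HasDerivAt (fun x => Real.arsinh (x / k)) (√(k ^ 2 + x ^ 2))⁻¹ x := by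
  refine ((hasDerivAt_id x).div_const k).arsinh.congr_deriv ?_
  have hradicand : k ^ 2 + x ^ 2 = k ^ 2 * (1 + (x / k) ^ 2) := by field_simp
  rw [hradicand, Real.sqrt_mul (sq_nonneg k), Real.sqrt_sq hk.le, mul_inv, smul_eq_mul, one_div,
    mul_comm, id]

theorem neg_log_le_arsinh_div (hk : 0 < k) {c : ℝ} (hc : 1 ≤ c) :
    -Real.log k ≤ Real.arsinh (c / k) := by
  rw [← Real.log_inv, Real.arsinh]
  refine Real.log_le_log (inv_pos.2 hk) ?_
  have hinv : k⁻¹ ≤ c / k := by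
    rw [inv_eq_one_div]
    gcongr
  linarith [Real.sqrt_nonneg (1 + (c / k) ^ 2)]

theorem arsinh_one_div_le_neg_log_add_two (hk : 0 < k) (hk1 : k ≤ 1) :
    Real.arsinh (1 / k) ≤ -Real.log k + 2 := by
  have hone : 1 ≤ 1 / k := one_le_one_div hk hk1
  have hsqrt : √(1 + (1 / k) ^ 2) ≤ 2 * (1 / k) :=
    Real.sqrt_le_iff.2 ⟨by positivity, by nlinarith⟩
  calc Real.arsinh (1 / k) = Real.log (1 / k + √(1 + (1 / k) ^ 2)) := rfl
    _ ≤ Real.log (3 * k⁻¹) := Real.log_le_log (by positivity) (by rw [← one_div]; linarith)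
    _ = Real.log 3 - Real.log k := by
        rw [Real.log_mul three_ne_zero (inv_ne_zero hk.ne'), Real.log_inv, sub_eq_add_neg]
    _ ≤ -Real.log k + 2 := by linarith [Real.log_le_sub_one_of_pos (zero_lt_three' ℝ)]

theorem neg_log_le_gaussIntegral (hk : 0 < k) : -Real.log k ≤ gaussIntegral k 1 := by
  have hcont : Continuous fun x : ℝ => (√(k ^ 2 + x ^ 2))⁻¹ :=
    Continuous.inv₀ (by fun_prop) fun x => (Real.sqrt_pos.2 (by positivity)).ne'
  calc -Real.log k ≤ Real.arsinh (Real.pi / 2 / k) :=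
        neg_log_le_arsinh_div hk Real.one_le_pi_div_two
    _ = ∫ x in (0 : ℝ)..(Real.pi / 2), (√(k ^ 2 + x ^ 2))⁻¹ := by
        rw [intervalIntegral.integral_eq_sub_of_hasDerivAt
          (fun x _ => hasDerivAt_arsinh_div hk x) (hcont.intervalIntegrable _ _), zero_div,
          Real.arsinh_zero, sub_zero]
    _ ≤ gaussIntegral k 1 :=
        intervalIntegral.integral_mono_on Real.pi_div_two_pos.le (hcont.intervalIntegrable _ _)
          (gaussIntegrand_intervalIntegrable hk one_pos _ _) fun θ hθ => ?_
  refine inv_anti₀ (Real.sqrt_pos.2 (gaussIntegrand_radicand_pos hk one_pos θ))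
    (Real.sqrt_le_sqrt (add_le_add ?_ ?_))
  · exact mul_le_of_le_one_right (sq_nonneg k) (Real.cos_sq_le_one θ)
  · rw [one_pow, one_mul, sq_le_sq, abs_of_nonneg hθ.1]
    exact Real.abs_sin_le_abs.trans_eq (abs_of_nonneg hθ.1)

theorem hasDerivAt_arsinh_tan_div (hk : 0 < k) {θ : ℝ} (hcos : 0 < Real.cos θ) :
    HasDerivAt (fun θ => Real.arsinh (Real.tan θ / k))
      ((Real.cos θ)⁻¹ * gaussIntegrand k 1 θ) θ := by
  refine ((hasDerivAt_arsinh_div hk (Real.tan θ)).comp θ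
    (Real.hasDerivAt_tan hcos.ne')).congr_deriv ?_
  have hradicand : k ^ 2 * Real.cos θ ^ 2 + 1 ^ 2 * Real.sin θ ^ 2 =
      Real.cos θ ^ 2 * (k ^ 2 + Real.tan θ ^ 2) := by
    rw [Real.tan_eq_sin_div_cos]
    field_simp
  rw [gaussIntegrand, hradicand, Real.sqrt_mul (sq_nonneg _), Real.sqrt_sq hcos.le, mul_inv]
  field_simp

theorem integral_gaussIntegrand_zero_pi_div_four_le (hk : 0 < k) :
    ∫ θ in (0 : ℝ)..(Real.pi / 4), gaussIntegrand k 1 θ ≤ Real.arsinh (1 / k) := by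
  have hcos : ∀ θ ∈ Set.Icc 0 (Real.pi / 4), 0 < Real.cos θ := fun θ hθ =>
    Real.cos_pos_of_mem_Ioo ⟨by linarith [hθ.1, Real.pi_pos], by linarith [hθ.2, Real.pi_pos]⟩
  have hle : 0 ≤ Real.pi / 4 := by positivity
  have hint : IntervalIntegrable (fun θ => (Real.cos θ)⁻¹ * gaussIntegrand k 1 θ) volume 0
      (Real.pi / 4) := by
    refine ContinuousOn.intervalIntegrable ?_
    rw [Set.uIcc_of_le hle]
    exact (Real.continuous_cos.continuousOn.inv₀ fun θ hθ => (hcos θ hθ).ne').mul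
      (gaussIntegrand_continuous hk one_pos).continuousOn
  calc ∫ θ in (0 : ℝ)..(Real.pi / 4), gaussIntegrand k 1 θ
      ≤ ∫ θ in (0 : ℝ)..(Real.pi / 4), (Real.cos θ)⁻¹ * gaussIntegrand k 1 θ :=
        intervalIntegral.integral_mono_on hle (gaussIntegrand_intervalIntegrable hk one_pos _ _)
          hint fun θ hθ => le_mul_of_one_le_left (gaussIntegrand_pos hk one_pos θ).le
            ((one_le_inv₀ (hcos θ hθ)).2 (Real.cos_le_one θ))
    _ = Real.arsinh (1 / k) := by
        rw [intervalIntegral.integral_eq_sub_of_hasDerivAt (fun θ hθ => hasDerivAt_arsinh_tan_div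
          hk (hcos θ (by rwa [Set.uIcc_of_le hle] at hθ))) hint, Real.tan_pi_div_four,
          Real.tan_zero, zero_div, Real.arsinh_zero, sub_zero]

theorem integral_gaussIntegrand_pi_div_four_pi_div_two_le (hk : 0 < k) :
    ∫ θ in (Real.pi / 4)..(Real.pi / 2), gaussIntegrand k 1 θ ≤ 2 := by
  have hle : Real.pi / 4 ≤ Real.pi / 2 := by linarith [Real.pi_pos]
  calc ∫ θ in (Real.pi / 4)..(Real.pi / 2), gaussIntegrand k 1 θ
      ≤ ∫ _ in (Real.pi / 4)..(Real.pi / 2), (2 : ℝ) :=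
        intervalIntegral.integral_mono_on hle (gaussIntegrand_intervalIntegrable hk one_pos _ _)
          intervalIntegrable_const fun θ hθ => ?_
    _ = (Real.pi / 2 - Real.pi / 4) * 2 := by rw [intervalIntegral.integral_const, smul_eq_mul]
    _ ≤ 2 := by linarith [Real.pi_lt_four]
  have hsin : 1 / 2 ≤ Real.sin θ := by
    have hmono : Real.sin (Real.pi / 4) ≤ Real.sin θ :=
      Real.sin_le_sin_of_le_of_le_pi_div_two (by linarith [Real.pi_pos]) hθ.2 hθ.1
    rw [Real.sin_pi_div_four] at hmono
    linarith [Real.one_le_sqrt.2 one_le_two]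
  have hsqrt : 1 / 2 ≤ √(k ^ 2 * Real.cos θ ^ 2 + 1 ^ 2 * Real.sin θ ^ 2) :=
    Real.le_sqrt_of_sq_le (by nlinarith [sq_nonneg (k * Real.cos θ)])
  exact (inv_anti₀ one_half_pos hsqrt).trans_eq (by norm_num)

theorem gaussIntegral_le_neg_log_add_four (hk : 0 < k) (hk1 : k ≤ 1) :
    gaussIntegral k 1 ≤ -Real.log k + 4 := by
  rw [gaussIntegral, ← intervalIntegral.integral_add_adjacent_intervals
    (gaussIntegrand_intervalIntegrable hk one_pos 0 (Real.pi / 4))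
    (gaussIntegrand_intervalIntegrable hk one_pos _ _)]
  linarith [integral_gaussIntegrand_zero_pi_div_four_le hk,
    integral_gaussIntegrand_pi_div_four_pi_div_two_le hk, arsinh_one_div_le_neg_log_add_two hk hk1]

end Estimates

theorem ellK_ofReal {m : ℝ} (hm : m < 1) : ellK m = (gaussIntegral 1 (√(1 - m)) : ℝ) := by
  rw [ellK, gaussIntegral, ← intervalIntegral.integral_ofReal]
  congr 1
  ext θ
  have hradicand : (1 : ℝ) ^ 2 * Real.cos θ ^ 2 + √(1 - m) ^ 2 * Real.sin θ ^ 2 =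
      1 - m * Real.sin θ ^ 2 := by
    rw [Real.sq_sqrt (sub_nonneg.2 hm.le), Real.cos_sq']
    ring
  have hpos := gaussIntegrand_radicand_pos one_pos (Real.sqrt_pos.2 (sub_pos.2 hm)) θ
  rw [hradicand] at hpos
  have hcast : (1 - m * (Real.sin θ : ℂ) ^ 2) ^ (-(1 / 2) : ℂ) =
      ((1 - m * Real.sin θ ^ 2 : ℝ) : ℂ) ^ ((-(1 / 2) : ℝ) : ℂ) := by push_cast; rfl
  rw [hcast, ← Complex.ofReal_cpow hpos.le, Real.rpow_neg hpos.le, ← Real.sqrt_eq_rpow,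
    gaussIntegrand, hradicand]

/-! ### The nome on the interval `(0, 1)` -/

/-- The exponent `π K(1-m) / K(m)` of the nome for a real parameter `m`, in terms of Gauss's
integral. -/
def realExponent (m : ℝ) : ℝ :=
  Real.pi * gaussIntegral 1 √m / gaussIntegral 1 √(1 - m)

/-- The descending Landen transformation of the parameter, that is, `ψ₁²` on `(0, 1)`. -/
def landen (m : ℝ) : ℝ := ((1 - √(1 - m)) / (1 + √(1 - m))) ^ 2

section Landen

variable {m : ℝ}

theorem sqrt_one_sub_lt_one (h0 : 0 < m) : √(1 - m) < 1 := by
  rw [Real.sqrt_lt' one_pos]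
  linarith

theorem mapsTo_landen : Set.MapsTo landen (Set.Ioo 0 1) (Set.Ioo 0 1) := by
  intro m hm
  have hk : 0 < √(1 - m) := Real.sqrt_pos.2 (sub_pos.2 hm.2)
  have hpos : 0 < (1 - √(1 - m)) / (1 + √(1 - m)) :=
    div_pos (sub_pos.2 (sqrt_one_sub_lt_one hm.1)) (by positivity)
  have hlt : (1 - √(1 - m)) / (1 + √(1 - m)) < 1 := by
    rw [div_lt_one (by positivity)]
    linarith
  exact ⟨pow_pos hpos 2, pow_lt_one₀ hpos.le hlt two_ne_zero⟩

theorem psiOne_ofReal_sq (h1 : m < 1) : psiOne m ^ 2 = (landen m : ℝ) := by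
  rw [psiOne, ← Complex.ofReal_one, ← Complex.ofReal_sub, csqrt_ofReal (sub_nonneg.2 h1.le),
    landen]
  push_cast
  rfl

theorem gaussIntegral_one_sqrt_landen (h0 : 0 < m) (h1 : m < 1) :
    gaussIntegral 1 √(landen m) = (1 + √(1 - m)) * gaussIntegral 1 √m := by
  set k := √(1 - m) with hk
  have hpos : 0 < 1 + k := by positivity
  have hneg : 0 < 1 - k := sub_pos.2 (sqrt_one_sub_lt_one h0)
  have hsq : k ^ 2 = 1 - m := Real.sq_sqrt (sub_nonneg.2 h1.le)
  have hscale := gaussIntegral_const_mul (inv_pos.2 hpos).le (1 + k) (1 - k)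
  rw [inv_mul_cancel₀ hpos.ne', inv_inv, ← gaussIntegral_agm hpos hneg] at hscale
  rw [landen, ← hk, Real.sqrt_sq (by positivity), div_eq_inv_mul, hscale]
  congr 2
  · ring
  · congr 1
    linear_combination -hsq

theorem gaussIntegral_one_sqrt_one_sub_landen (h1 : m < 1) :
    gaussIntegral 1 √(1 - landen m) = (1 + √(1 - m)) / 2 * gaussIntegral 1 √(1 - m) := by
  set k := √(1 - m) with hk
  have hpos : 0 < k := Real.sqrt_pos.2 (sub_pos.2 h1)
  have hscale : √(1 - landen m) = 2 / (1 + k) * √(1 * k) := by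
    have hsq : 1 - landen m = (2 / (1 + k)) ^ 2 * k := by
      rw [landen, ← hk]
      field_simp
      ring
    rw [hsq, Real.sqrt_mul (sq_nonneg _), Real.sqrt_sq (by positivity), one_mul]
  calc gaussIntegral 1 √(1 - landen m)
      = gaussIntegral (2 / (1 + k) * ((1 + k) / 2)) (2 / (1 + k) * √(1 * k)) := by
        have hne : 1 + k ≠ 0 := by positivity
        rw [hscale, div_mul_div_cancel₀' two_ne_zero, div_self hne]
    _ = (1 + k) / 2 * gaussIntegral 1 k := by
        rw [gaussIntegral_const_mul (by positivity), gaussIntegral_agm one_pos hpos, inv_div]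

theorem realExponent_landen (h0 : 0 < m) (h1 : m < 1) :
    realExponent (landen m) = 2 * realExponent m := by
  have hpos := gaussIntegral_pos one_pos (Real.sqrt_pos.2 (sub_pos.2 h1))
  rw [realExponent, gaussIntegral_one_sqrt_landen h0 h1, gaussIntegral_one_sqrt_one_sub_landen h1,
    realExponent]
  field_simp

end Landen

section LogarithmicBounds

variable {m : ℝ}

theorem realExponent_le (h0 : 0 < m) (h1 : m < 1) :
    realExponent m ≤ 2 * gaussIntegral 1 √m := by
  have hk0 : 0 < √(1 - m) := Real.sqrt_pos.2 (sub_pos.2 h1)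
  have hN := gaussIntegral_pos one_pos (Real.sqrt_pos.2 h0)
  rw [realExponent, div_le_iff₀ (gaussIntegral_pos one_pos hk0)]
  nlinarith [pi_div_two_le_gaussIntegral_one hk0 (sqrt_one_sub_lt_one h0).le]

theorem le_realExponent (h0 : 0 < m) (h1 : m < 1) :
    2 * gaussIntegral 1 √m * (1 - m) ≤ realExponent m := by
  set k := √(1 - m)
  have hk0 : 0 < k := Real.sqrt_pos.2 (sub_pos.2 h1)
  have hk1 : k ≤ 1 := (sqrt_one_sub_lt_one h0).le
  have hsq : k ^ 2 = 1 - m := Real.sq_sqrt (sub_nonneg.2 h1.le)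
  have hN := gaussIntegral_pos one_pos (Real.sqrt_pos.2 h0)
  have hle : (1 - m) * gaussIntegral 1 k ≤ Real.pi / 2 := by
    calc (1 - m) * gaussIntegral 1 k ≤ k ^ 2 * (Real.pi / 2 * k⁻¹) := by
          rw [← hsq]
          gcongr
          exact gaussIntegral_one_le_pi_div_two_mul_inv hk0 hk1
      _ = Real.pi / 2 * k := by field_simp
      _ ≤ Real.pi / 2 := mul_le_of_le_one_right Real.pi_div_two_pos.le hk1
  rw [realExponent, le_div_iff₀ (gaussIntegral_pos one_pos hk0)]
  nlinarith

theorem mul_neg_log_le_one (h0 : 0 < m) : m * -Real.log m ≤ 1 := by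
  rw [← Real.log_inv]
  calc m * Real.log m⁻¹ ≤ m * (m⁻¹ - 1) := by
        gcongr
        exact Real.log_le_sub_one_of_pos (inv_pos.2 h0)
    _ = 1 - m := by rw [mul_sub, mul_inv_cancel₀ h0.ne', mul_one]
    _ ≤ 1 := sub_le_self 1 h0.le

theorem abs_realExponent_add_log_le (h0 : 0 < m) (h1 : m < 1) :
    |realExponent m + Real.log m| ≤ 8 := by
  have hs0 : 0 < √m := Real.sqrt_pos.2 h0
  have hs1 : √m ≤ 1 := Real.sqrt_le_one.2 h1.le
  have hge := neg_log_le_gaussIntegral hs0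
  have hle := gaussIntegral_le_neg_log_add_four hs0 hs1
  rw [gaussIntegral_comm, Real.log_sqrt h0.le] at hge hle
  rw [abs_le]
  constructor
  · have hmul := mul_le_mul_of_nonneg_right hge (sub_nonneg.2 h1.le)
    linarith [le_realExponent h0 h1, mul_neg_log_le_one h0]
  · linarith [realExponent_le h0 h1]

theorem abs_log_norm_psiLim_sub_log_le (h0 : 0 < m) (h1 : m < 1) :
    |Real.log ‖psiLim m‖ - Real.log m| ≤ Real.log 81 := by
  have hmem := ofReal_mem_oneCutPlane h1
  have hnorm : ‖(m : ℂ)‖ = m := Complex.norm_of_nonneg h0.le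
  have hle : ‖psiLim m‖ ≤ m :=
    ((norm_psiLim_le hmem).trans (norm_psiOne_le m)).trans_eq hnorm
  have hge : m / 81 ≤ ‖psiLim m‖ := by
    have hpsiOne := le_norm_psiOne (hnorm.trans_le h1.le)
    rw [hnorm] at hpsiOne
    linarith [le_norm_psiLim hmem]
  have hlog_le := Real.log_le_log ((by positivity : 0 < m / 81).trans_le hge) hle
  have hlog_ge := Real.log_le_log (by positivity) hge
  rw [Real.log_div h0.ne' (by norm_num)] at hlog_ge
  exact abs_le.2 ⟨by linarith, by linarith [Real.log_nonneg (by norm_num : (1 : ℝ) ≤ 81)]⟩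

end LogarithmicBounds

theorem eq_zero_of_succ_eq_two_mul {u : ℕ → ℝ} {C : ℝ} (hu : ∀ n, u (n + 1) = 2 * u n)
    (hC : ∀ n, |u n| ≤ C) : u 0 = 0 := by
  have hpow : ∀ n, u n = 2 ^ n * u 0 := fun n => by
    induction n with
    | zero => rw [pow_zero, one_mul]
    | succ n ih => rw [hu, ih, pow_succ']; ring
  by_contra h0
  obtain ⟨n, hn⟩ := pow_unbounded_of_one_lt (C / |u 0|) one_lt_two
  rw [div_lt_iff₀ (abs_pos.2 h0)] at hn
  refine (hC n).not_gt ?_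
  rwa [hpow, abs_mul, abs_of_pos (by positivity)]

/- Both `realExponent` and `-log ‖psiLim‖` double under the Landen transformation and differ from
`-log` by a bounded amount, so their difference is a bounded quantity that doubles. -/
theorem realExponent_eq_neg_log_norm_psiLim {m : ℝ} (h0 : 0 < m) (h1 : m < 1) :
    realExponent m = -Real.log ‖psiLim m‖ := by
  set f : ℝ → ℝ := fun x => realExponent x + Real.log ‖psiLim x‖
  have hdouble : ∀ x, 0 < x → x < 1 → f (landen x) = 2 * f x := fun x hx0 hx1 => by
    simp only [f]
    rw [realExponent_landen hx0 hx1, ← psiOne_ofReal_sq hx1,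
      ← psiLim_sq (ofReal_mem_oneCutPlane hx1), norm_pow, Real.log_pow, Nat.cast_two, mul_add]
  have hbound : ∀ x, 0 < x → x < 1 → |f x| ≤ 8 + Real.log 81 := fun x hx0 hx1 => by
    calc |f x| = |(realExponent x + Real.log x) + (Real.log ‖psiLim x‖ - Real.log x)| := by
          rw [add_add_sub_cancel]
      _ ≤ 8 + Real.log 81 := (abs_add_le _ _).trans (add_le_add
          (abs_realExponent_add_log_le hx0 hx1) (abs_log_norm_psiLim_sub_log_le hx0 hx1))
  have hmem : ∀ n, landen^[n] m ∈ Set.Ioo (0 : ℝ) 1 := fun n => mapsTo_landen.iterate n ⟨h0, h1⟩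
  refine eq_neg_of_add_eq_zero_left
    (eq_zero_of_succ_eq_two_mul (u := fun n => f (landen^[n] m)) (fun n => ?_)
      fun n => hbound _ (hmem n).1 (hmem n).2)
  rw [Function.iterate_succ_apply']
  exact hdouble _ (hmem n).1 (hmem n).2

theorem nome_ofReal {m : ℝ} (h0 : 0 < m) (h1 : m < 1) : nome m = psiLim m := by
  have hm : (m : ℂ) ≠ 0 := Complex.ofReal_ne_zero.2 h0.ne'
  have hpos : 0 < ‖psiLim m‖ := norm_pos_iff.2 (psiLim_ne_zero (ofReal_mem_oneCutPlane h1) hm)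
  have hcast : -(Real.pi : ℂ) * ellK (1 - m) / ellK m = ((-realExponent m : ℝ) : ℂ) := by
    rw [← Complex.ofReal_one, ← Complex.ofReal_sub, ellK_ofReal h1,
      ellK_ofReal (sub_lt_self 1 h0), sub_sub_cancel, realExponent]
    push_cast
    ring
  rw [nome, if_neg hm, hcast, realExponent_eq_neg_log_norm_psiLim h0 h1, neg_neg,
    ← Complex.ofReal_exp, Real.exp_log hpos, ← psiLim_ofReal_eq_norm h0.le h1]

/-! ### The nome on the one-cut plane -/

section EllipticIntegral

variable {m : ℂ}

theorem one_sub_mul_sin_sq_mem_slitPlane (hm : m ∈ oneCutPlane) (θ : ℝ) :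
    1 - m * ((Real.sin θ : ℝ) : ℂ) ^ 2 ∈ Complex.slitPlane := by
  have hsum : ((Real.cos θ : ℝ) : ℂ) ^ 2 + ((Real.sin θ : ℝ) : ℂ) ^ 2 = 1 := by
    exact_mod_cast Real.cos_sq_add_sin_sq θ
  have hstar := Complex.starConvex_one_slitPlane (mem_oneCutPlane_iff.1 hm)
    (sq_nonneg (Real.cos θ)) (sq_nonneg (Real.sin θ)) (Real.cos_sq_add_sin_sq θ)
  convert hstar using 1
  simp only [Complex.real_smul, Complex.ofReal_pow]
  linear_combination -hsum

theorem ellK_integrand_continuous (hm : m ∈ oneCutPlane) :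
    Continuous fun θ : ℝ => (1 - m * ((Real.sin θ : ℝ) : ℂ) ^ 2) ^ (-(1 / 2) : ℂ) :=
  Continuous.cpow (by fun_prop) continuous_const (one_sub_mul_sin_sq_mem_slitPlane hm)

theorem differentiableOn_intervalIntegral {F F' : ℂ → ℝ → ℂ} {U : Set ℂ} {a b : ℝ}
    (hU : IsOpen U) (hF : ∀ z ∈ U, Continuous (F z))
    (hF' : ContinuousOn (Function.uncurry F') (U ×ˢ Set.univ))
    (hderiv : ∀ z ∈ U, ∀ x, HasDerivAt (F · x) (F' z x) z) :
    DifferentiableOn ℂ (fun z => ∫ x in a..b, F z x) U := by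
  intro z₀ hz₀
  obtain ⟨ε, hε, hball⟩ := Metric.nhds_basis_closedBall.mem_iff.1 (hU.mem_nhds hz₀)
  obtain ⟨C, hC⟩ := ((isCompact_closedBall z₀ ε).prod isCompact_uIcc).exists_bound_of_continuousOn
    (hF'.mono (Set.prod_mono hball (Set.subset_univ (Set.uIcc a b))))
  have hF'_cont : Continuous (F' z₀) :=
    hF'.comp_continuous (by fun_prop : Continuous fun x : ℝ => (z₀, x)) fun _ =>
      ⟨hz₀, Set.mem_univ _⟩
  have hint := intervalIntegral.hasDerivAt_integral_of_dominated_loc_of_deriv_le (𝕜 := ℂ)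
    (μ := volume) (a := a) (b := b) (bound := fun _ => C) (F := F) (F' := F')
    (Metric.closedBall_mem_nhds z₀ hε)
    (eventually_of_mem (hU.mem_nhds hz₀) fun z hz => (hF z hz).aestronglyMeasurable)
    ((hF z₀ hz₀).intervalIntegrable _ _) hF'_cont.aestronglyMeasurable
    (Eventually.of_forall fun x hx z hz => hC (z, x) ⟨hz, Set.uIoc_subset_uIcc hx⟩)
    intervalIntegrable_const (Eventually.of_forall fun x _ z hz => hderiv z (hball hz) x)
  exact hint.2.differentiableAt.differentiableWithinAt

theorem ellK_differentiableOn : DifferentiableOn ℂ ellK oneCutPlane := by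
  refine differentiableOn_intervalIntegral
    (F' := fun m θ => (-(1 / 2) : ℂ) * (1 - m * ((Real.sin θ : ℝ) : ℂ) ^ 2) ^ (-(1 / 2) - 1 : ℂ) *
      (-((Real.sin θ : ℝ) : ℂ) ^ 2))
    isOpen_oneCutPlane (fun m hm => ellK_integrand_continuous hm) ?_ fun m hm θ => ?_
  · refine (continuousOn_const.mul (ContinuousOn.cpow (by fun_prop) continuousOn_const ?_)).mul
      (by fun_prop)
    exact fun p hp => one_sub_mul_sin_sq_mem_slitPlane hp.1 p.2
  · have hbase : HasDerivAt (fun m : ℂ => 1 - m * ((Real.sin θ : ℝ) : ℂ) ^ 2)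
        (-((Real.sin θ : ℝ) : ℂ) ^ 2) m := by
      simpa only [id_eq, one_mul] using
        ((hasDerivAt_id m).mul_const (((Real.sin θ : ℝ) : ℂ) ^ 2)).const_sub 1
    exact hbase.cpow_const (one_sub_mul_sin_sq_mem_slitPlane hm θ)

theorem ellK_re_pos (hm : m ∈ oneCutPlane) : 0 < (ellK m).re := by
  have hcont := ellK_integrand_continuous hm
  have hre := Complex.reCLM.intervalIntegral_comp_comm
    (hcont.intervalIntegrable (μ := volume) 0 (Real.pi / 2))
  change 0 < Complex.reCLM (ellK m)
  rw [ellK, ← hre]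
  refine intervalIntegral.intervalIntegral_pos_of_pos
    ((Complex.reCLM.continuous.comp hcont).intervalIntegrable _ _) (fun θ => ?_)
    Real.pi_div_two_pos
  have hpos := csqrt_re_pos (one_sub_mul_sin_sq_mem_slitPlane hm θ)
  rw [Complex.reCLM_apply, Complex.cpow_neg, Complex.inv_re]
  exact div_pos hpos (Complex.normSq_pos.2 (Complex.ne_zero_of_re_pos hpos))

theorem ellK_ne_zero (hm : m ∈ oneCutPlane) : ellK m ≠ 0 :=
  Complex.ne_zero_of_re_pos (ellK_re_pos hm)

end EllipticIntegral

/-- The plane `ℂ \ ((-∞, 0] ∪ [1, ∞))`, where both `K(ω)` and `K(1 - ω)` are analytic. -/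
def twoCutPlane : Set ℂ := Complex.slitPlane ∩ oneCutPlane

section TwoCutPlane

variable {ω : ℂ}

theorem one_sub_mem_oneCutPlane_iff : 1 - ω ∈ oneCutPlane ↔ ω ∈ Complex.slitPlane := by
  rw [mem_oneCutPlane_iff, sub_sub_cancel]

theorem one_sub_mem_twoCutPlane (h : ω ∈ twoCutPlane) : 1 - ω ∈ twoCutPlane :=
  ⟨mem_oneCutPlane_iff.1 h.2, one_sub_mem_oneCutPlane_iff.2 h.1⟩

theorem isOpen_twoCutPlane : IsOpen twoCutPlane :=
  Complex.isOpen_slitPlane.inter isOpen_oneCutPlane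

theorem mem_twoCutPlane_of_im_ne_zero (h : ω.im ≠ 0) : ω ∈ twoCutPlane :=
  ⟨Or.inr h, fun hω => h hω.1⟩

theorem ofReal_mem_twoCutPlane {x : ℝ} (h0 : 0 < x) (h1 : x < 1) : (x : ℂ) ∈ twoCutPlane :=
  ⟨Complex.ofReal_mem_slitPlane.2 h0, ofReal_mem_oneCutPlane h1⟩

theorem ne_zero_of_mem_twoCutPlane (h : ω ∈ twoCutPlane) : ω ≠ 0 :=
  Complex.slitPlane_ne_zero h.1

theorem starConvex_twoCutPlane {x : ℝ} (h0 : 0 < x) (h1 : x < 1) :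
    StarConvex ℝ (x : ℂ) twoCutPlane := by
  refine (Complex.starConvex_ofReal_slitPlane h0).inter fun ω hω a b ha hb hab => ?_
  have hab' : (a : ℂ) + b = 1 := by exact_mod_cast hab
  have hstar := Complex.starConvex_ofReal_slitPlane (sub_pos.2 h1) (mem_oneCutPlane_iff.1 hω)
    ha hb hab
  rw [mem_oneCutPlane_iff]
  convert hstar using 1
  simp only [Complex.real_smul, Complex.ofReal_sub, Complex.ofReal_one]
  linear_combination -hab'

theorem isPreconnected_twoCutPlane : IsPreconnected twoCutPlane :=
  ((starConvex_twoCutPlane one_half_pos one_half_lt_one).isPathConnected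
    (ofReal_mem_twoCutPlane one_half_pos one_half_lt_one)).isConnected.isPreconnected

end TwoCutPlane

/-- The exponent `π K(1-ω) / K(ω)` of the nome. -/
def nomeExponent (ω : ℂ) : ℂ := Real.pi * ellK (1 - ω) / ellK ω

section NomeExponent

variable {ω : ℂ}

theorem nome_eq_exp (h : ω ≠ 0) : nome ω = Complex.exp (-nomeExponent ω) := by
  rw [nome, if_neg h, nomeExponent, neg_mul, neg_div]

theorem nomeExponent_differentiableOn : DifferentiableOn ℂ nomeExponent twoCutPlane := by
  have hone_sub : DifferentiableOn ℂ (fun ω => ellK (1 - ω)) twoCutPlane :=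
    ellK_differentiableOn.comp (by fun_prop) fun _ h => one_sub_mem_oneCutPlane_iff.2 h.1
  exact (hone_sub.const_mul _).div (ellK_differentiableOn.mono fun _ h => h.2)
    fun _ h => ellK_ne_zero h.2

theorem nomeExponent_one_sub (h : ω ∈ twoCutPlane) :
    nomeExponent (1 - ω) = (Real.pi : ℂ) ^ 2 / nomeExponent ω := by
  have hK := ellK_ne_zero h.2
  have hK' := ellK_ne_zero (one_sub_mem_oneCutPlane_iff.2 h.1)
  have hpi : (Real.pi : ℂ) ≠ 0 := Complex.ofReal_ne_zero.2 Real.pi_ne_zero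
  rw [nomeExponent, nomeExponent, sub_sub_cancel]
  field_simp

theorem nome_differentiableOn_twoCutPlane : DifferentiableOn ℂ nome twoCutPlane :=
  nomeExponent_differentiableOn.neg.cexp.congr fun _ h =>
    nome_eq_exp (ne_zero_of_mem_twoCutPlane h)

theorem frequently_ofReal_nhdsNE {p : ℂ → Prop} {a b x : ℝ} (hx : x ∈ Set.Ioo a b)
    (hp : ∀ y ∈ Set.Ioo a b, p y) : ∃ᶠ z in 𝓝[≠] (x : ℂ), p z := by
  have hcoe : Tendsto (fun y : ℝ => (y : ℂ)) (𝓝[≠] x) (𝓝[≠] (x : ℂ)) :=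
    Complex.continuous_ofReal.continuousWithinAt.tendsto_nhdsWithin
      fun y hy => Complex.ofReal_injective.ne hy
  exact hcoe.frequently ((eventually_of_mem
    (mem_nhdsWithin_of_mem_nhds (Ioo_mem_nhds hx.1 hx.2)) hp).frequently)

theorem nome_eq_psiLim_of_mem_twoCutPlane (h : ω ∈ twoCutPlane) : nome ω = psiLim ω := by
  have hnome := nome_differentiableOn_twoCutPlane.analyticOnNhd isOpen_twoCutPlane
  exact hnome.eqOn_of_preconnected_of_frequently_eq
    ((psiLim_differentiableOn.mono fun _ h => h.2).analyticOnNhd isOpen_twoCutPlane)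
    isPreconnected_twoCutPlane (ofReal_mem_twoCutPlane one_half_pos one_half_lt_one)
    (frequently_ofReal_nhdsNE ⟨one_half_pos, one_half_lt_one⟩ fun _ hy => nome_ofReal hy.1 hy.2) h

end NomeExponent

theorem intervalIntegrable_abs_rpow {r : ℝ} (hr : -1 < r) (t : ℝ) :
    IntervalIntegrable (fun x => |x| ^ r) volume 0 t := by
  have hnonneg : ∀ t : ℝ, 0 ≤ t → IntervalIntegrable (fun x => |x| ^ r) volume 0 t := by
    intro t ht
    refine (intervalIntegral.intervalIntegrable_rpow' hr).congr fun x hx => ?_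
    rw [Set.uIoc_of_le ht] at hx
    simp only [abs_of_pos hx.1]
  rcases le_total 0 t with ht | ht
  · exact hnonneg t ht
  · simpa only [zero_sub, sub_zero, neg_neg, abs_neg, zero_add, neg_zero] using
      (hnonneg (-t) (neg_nonneg.2 ht)).comp_sub_left 0

theorem intervalIntegrable_abs_sub_rpow {r : ℝ} (hr : -1 < r) (c a b : ℝ) :
    IntervalIntegrable (fun x => |x - c| ^ r) volume a b := by
  simpa only [sub_add_cancel] using
    ((intervalIntegrable_abs_rpow hr (a - c)).symm.trans
      (intervalIntegrable_abs_rpow hr (b - c))).comp_sub_right c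

theorem min_sin_cos_le_sin_add {θ₀ θ : ℝ} (h₀ : θ₀ ∈ Set.Icc 0 (Real.pi / 2))
    (h : θ ∈ Set.Icc 0 (Real.pi / 2)) :
    min (Real.sin θ₀) (Real.cos θ₀) ≤ Real.sin (θ₀ + θ) := by
  have hpi := Real.pi_pos
  have hsin₀ := Real.sin_nonneg_of_nonneg_of_le_pi h₀.1 (by linarith [h₀.2])
  have hcos₀ := Real.cos_nonneg_of_mem_Icc ⟨by linarith [h₀.1], h₀.2⟩
  have hsin := Real.sin_nonneg_of_nonneg_of_le_pi h.1 (by linarith [h.2])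
  have hcos := Real.cos_nonneg_of_mem_Icc ⟨by linarith [h.1], h.2⟩
  have hone : 1 ≤ Real.sin θ + Real.cos θ := by
    nlinarith [Real.sin_sq_add_cos_sq θ, mul_nonneg hsin hcos]
  set c := min (Real.sin θ₀) (Real.cos θ₀)
  calc c ≤ c * (Real.sin θ + Real.cos θ) := le_mul_of_one_le_right (le_min hsin₀ hcos₀) hone
    _ = c * Real.cos θ + c * Real.sin θ := by ring
    _ ≤ Real.sin θ₀ * Real.cos θ + Real.cos θ₀ * Real.sin θ := by
        gcongr
        · exact min_le_left _ _
        · exact min_le_right _ _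
    _ = Real.sin (θ₀ + θ) := (Real.sin_add θ₀ θ).symm

theorem two_div_pi_mul_abs_le_abs_sin {x : ℝ} (hx : |x| ≤ Real.pi / 2) :
    2 / Real.pi * |x| ≤ |Real.sin x| := by
  have hpi := Real.pi_pos
  rw [Real.abs_sin_eq_sin_abs_of_abs_le_pi (by linarith)]
  exact Real.mul_le_sin (abs_nonneg x) hx

theorem sin_sub_mul_sin_add (x y : ℝ) :
    Real.sin (x - y) * Real.sin (x + y) = Real.sin x ^ 2 - Real.sin y ^ 2 := by
  rw [Real.sin_sub, Real.sin_add]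
  linear_combination Real.sin x ^ 2 * Real.sin_sq_add_cos_sq y -
    Real.sin y ^ 2 * Real.sin_sq_add_cos_sq x

theorem exists_le_abs_one_sub_mul_sin_sq {M : ℝ} (hM : 1 < M) :
    ∃ c > 0, ∃ θ₀ : ℝ, ∀ θ ∈ Set.Icc 0 (Real.pi / 2),
      c * |θ - θ₀| ≤ |1 - M * Real.sin θ ^ 2| := by
  have hM0 : 0 < M := one_pos.trans hM
  have hs0 : 0 < √M⁻¹ := Real.sqrt_pos.2 (inv_pos.2 hM0)
  have hs1 : √M⁻¹ < 1 := (Real.sqrt_lt' one_pos).2 (by rw [one_pow]; exact inv_lt_one_of_one_lt₀ hM)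
  set θ₀ := Real.arcsin √M⁻¹
  have hsin : Real.sin θ₀ = √M⁻¹ := Real.sin_arcsin (by linarith) hs1.le
  have hθ₀0 : 0 < θ₀ := Real.arcsin_pos.2 hs0
  have hθ₀1 : θ₀ < Real.pi / 2 := Real.arcsin_lt_pi_div_two.2 hs1
  have hcos : 0 < Real.cos θ₀ := Real.cos_pos_of_mem_Ioo ⟨by linarith, hθ₀1⟩
  set c := min (Real.sin θ₀) (Real.cos θ₀)
  have hc : 0 < c := lt_min (hsin.symm ▸ hs0) hcos
  refine ⟨M * (2 / Real.pi * c), by positivity, θ₀, fun θ hθ => ?_⟩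
  have hdiff : 2 / Real.pi * |θ₀ - θ| ≤ |Real.sin (θ₀ - θ)| :=
    two_div_pi_mul_abs_le_abs_sin (abs_le.2 ⟨by linarith [hθ.2], by linarith [hθ.1]⟩)
  have hsum : c ≤ |Real.sin (θ₀ + θ)| :=
    (min_sin_cos_le_sin_add ⟨hθ₀0.le, hθ₀1.le⟩ hθ).trans (le_abs_self _)
  have hfactor : 1 - M * Real.sin θ ^ 2 = M * (Real.sin (θ₀ - θ) * Real.sin (θ₀ + θ)) := by
    rw [sin_sub_mul_sin_add, hsin, Real.sq_sqrt (inv_pos.2 hM0).le, mul_sub,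
      mul_inv_cancel₀ hM0.ne']
  calc M * (2 / Real.pi * c) * |θ - θ₀| = M * (2 / Real.pi * |θ₀ - θ| * c) := by
        rw [abs_sub_comm]; ring
    _ ≤ M * (|Real.sin (θ₀ - θ)| * |Real.sin (θ₀ + θ)|) := by gcongr
    _ = |1 - M * Real.sin θ ^ 2| := by rw [hfactor, abs_mul, abs_mul, abs_of_pos hM0]

theorem tendsto_ofReal_add_mul_I (x : ℝ) (s : ℝ) :
    Tendsto (fun ε : ℝ => (x : ℂ) + (ε * s : ℝ) * Complex.I) (𝓝[>] 0) (𝓝 x) := by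
  have hcont : Continuous fun ε : ℝ => (x : ℂ) + (ε * s : ℝ) * Complex.I := by fun_prop
  refine (hcont.tendsto' 0 x ?_).mono_left nhdsWithin_le_nhds
  rw [zero_mul, Complex.ofReal_zero, zero_mul, add_zero]

/- For `y < 0` the base approaches its limit on the cut from above, which is the side where the
principal logarithm is continuous. -/
theorem tendsto_ofReal_add_mul_I_cpow {y : ℝ} (hy : y ≠ 0) {s : ℝ} (hs : 0 ≤ s) (a : ℂ) :
    Tendsto (fun ε : ℝ => ((y : ℂ) + (ε * s : ℝ) * Complex.I) ^ a) (𝓝[>] 0)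
      (𝓝 ((y : ℂ) ^ a)) := by
  have hbase := tendsto_ofReal_add_mul_I y s
  have hy' : (y : ℂ) ≠ 0 := Complex.ofReal_ne_zero.2 hy
  have hlog : Tendsto (fun ε : ℝ => Complex.log ((y : ℂ) + (ε * s : ℝ) * Complex.I)) (𝓝[>] 0)
      (𝓝 (Complex.log y)) := by
    rcases hy.lt_or_gt with hneg | hpos
    · refine (Complex.continuousWithinAt_log_of_re_neg_of_im_zero (z := (y : ℂ)) hneg
        (Complex.ofReal_im y)).tendsto.comp
        (tendsto_nhdsWithin_of_tendsto_nhds_of_eventually_within _ hbase ?_)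
      filter_upwards [self_mem_nhdsWithin] with ε hε
      have him : ((y : ℂ) + (ε * s : ℝ) * Complex.I).im = ε * s := by simp
      exact him.symm ▸ mul_nonneg (le_of_lt hε) hs
    · exact (continuousAt_clog (Complex.ofReal_mem_slitPlane.2 hpos)).tendsto.comp hbase
  rw [Complex.cpow_def_of_ne_zero hy']
  refine ((Complex.continuous_exp.tendsto _).comp (hlog.mul_const a)).congr' ?_
  filter_upwards [hbase.eventually_ne hy'] with ε hε
  rw [Function.comp_apply, Complex.cpow_def_of_ne_zero hε]

theorem one_sub_sub_mul_I_mul_sin_sq (M ε θ : ℝ) :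
    1 - ((M : ℂ) - ε * Complex.I) * ((Real.sin θ : ℝ) : ℂ) ^ 2 =
      ((1 - M * Real.sin θ ^ 2 : ℝ) : ℂ) + (ε * Real.sin θ ^ 2 : ℝ) * Complex.I := by
  push_cast
  ring

theorem norm_ofReal_add_mul_I_cpow_neg_half_le {y : ℝ} (hy : y ≠ 0) (t : ℝ) :
    ‖((y : ℂ) + t * Complex.I) ^ (-(1 / 2) : ℂ)‖ ≤ |y| ^ (-(1 / 2) : ℝ) := by
  have hexp : (-(1 / 2) : ℂ) = ((-(1 / 2) : ℝ) : ℂ) := by push_cast; rfl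
  rw [hexp, Complex.norm_cpow_real]
  refine Real.rpow_le_rpow_of_nonpos (abs_pos.2 hy) ?_ (by norm_num)
  simpa using Complex.abs_re_le_norm ((y : ℂ) + t * Complex.I)

theorem tendsto_ellK_sub_mul_I {M : ℝ} (hM : 1 < M) :
    Tendsto (fun ε : ℝ => ellK ((M : ℂ) - ε * Complex.I)) (𝓝[>] 0) (𝓝 (ellK M)) := by
  obtain ⟨c, hc, θ₀, hθ₀⟩ := exists_le_abs_one_sub_mul_sin_sq hM
  have hlow : ∀ᵐ θ, θ ∈ Set.uIoc 0 (Real.pi / 2) →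
      0 < c * |θ - θ₀| ∧ c * |θ - θ₀| ≤ |1 - M * Real.sin θ ^ 2| := by
    filter_upwards [Measure.ae_ne volume θ₀] with θ hne hθ
    rw [Set.uIoc_of_le Real.pi_div_two_pos.le] at hθ
    exact ⟨mul_pos hc (abs_pos.2 (sub_ne_zero.2 hne)), hθ₀ θ (Set.Ioc_subset_Icc_self hθ)⟩
  refine intervalIntegral.tendsto_integral_filter_of_dominated_convergence
    (fun θ => c ^ (-(1 / 2) : ℝ) * |θ - θ₀| ^ (-(1 / 2) : ℝ)) ?_ ?_
    ((intervalIntegrable_abs_sub_rpow (by norm_num) θ₀ _ _).const_mul _) ?_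
  · filter_upwards [self_mem_nhdsWithin] with ε hε
    have him : ((M : ℂ) - ε * Complex.I).im ≠ 0 := by
      simpa using ne_of_gt hε
    exact (ellK_integrand_continuous (mem_twoCutPlane_of_im_ne_zero him).2).aestronglyMeasurable
  · refine Eventually.of_forall fun ε => ?_
    filter_upwards [hlow] with θ hlow hθ
    obtain ⟨hpos, hle⟩ := hlow hθ
    rw [one_sub_sub_mul_I_mul_sin_sq, ← Real.mul_rpow hc.le (abs_nonneg _)]
    exact (norm_ofReal_add_mul_I_cpow_neg_half_le (abs_pos.1 (hpos.trans_le hle)) _).trans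
      (Real.rpow_le_rpow_of_nonpos hpos hle (by norm_num))
  · filter_upwards [hlow] with θ hlow hθ
    obtain ⟨hpos, hle⟩ := hlow hθ
    have hlim := tendsto_ofReal_add_mul_I_cpow (abs_pos.1 (hpos.trans_le hle))
      (sq_nonneg (Real.sin θ)) (-(1 / 2))
    simp only [one_sub_sub_mul_I_mul_sin_sq]
    simpa only [Complex.ofReal_sub, Complex.ofReal_one, Complex.ofReal_mul, Complex.ofReal_pow]
      using hlim

theorem nome_eq_psiLim_of_neg {x : ℝ} (hx : x < 0) : nome x = psiLim x := by
  have hmem := ofReal_mem_oneCutPlane (hx.trans one_pos)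
  have hnhds := isOpen_oneCutPlane.mem_nhds hmem
  have hpath : Tendsto (fun ε : ℝ => (x : ℂ) + ε * Complex.I) (𝓝[>] 0) (𝓝 x) := by
    simpa only [mul_one] using tendsto_ofReal_add_mul_I x 1
  have hpsiLim := (psiLim_differentiableOn.differentiableAt hnhds).continuousAt.tendsto.comp hpath
  have hK := (ellK_differentiableOn.differentiableAt hnhds).continuousAt.tendsto.comp hpath
  have hK' : Tendsto (fun ε : ℝ => ellK (1 - ((x : ℂ) + ε * Complex.I))) (𝓝[>] 0)
      (𝓝 (ellK (1 - x))) := by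
    have hlim := tendsto_ellK_sub_mul_I (by linarith : 1 < 1 - x)
    rw [Complex.ofReal_sub, Complex.ofReal_one] at hlim
    simpa only [sub_add_eq_sub_sub] using hlim
  have hexp := (((hK'.const_mul (Real.pi : ℂ)).div hK (ellK_ne_zero hmem)).neg).cexp
  refine tendsto_nhds_unique ?_ hpsiLim
  rw [nome_eq_exp (Complex.ofReal_ne_zero.2 hx.ne)]
  refine hexp.congr' ?_
  filter_upwards [self_mem_nhdsWithin] with ε hε
  have htwoCut : (x : ℂ) + ε * Complex.I ∈ twoCutPlane :=
    mem_twoCutPlane_of_im_ne_zero (by simpa using ne_of_gt hε)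
  rw [Function.comp_apply, ← nome_eq_psiLim_of_mem_twoCutPlane htwoCut,
    nome_eq_exp (ne_zero_of_mem_twoCutPlane htwoCut)]
  rfl

theorem nome_zero : nome 0 = 0 := if_pos rfl

theorem nome_eqOn_psiLim : Set.EqOn nome psiLim oneCutPlane := by
  intro ω hω
  by_cases him : ω.im = 0
  · obtain ⟨x, rfl⟩ : ∃ x : ℝ, (x : ℂ) = ω := ⟨ω.re, Complex.ext rfl him.symm⟩
    have hx : x < 1 := by
      by_contra! h
      exact hω ⟨him, h⟩
    rcases lt_trichotomy x 0 with hneg | rfl | hpos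
    · exact nome_eq_psiLim_of_neg hneg
    · rw [Complex.ofReal_zero, psiLim_zero, nome_zero]
    · exact nome_ofReal hpos hx
  · exact nome_eq_psiLim_of_mem_twoCutPlane (mem_twoCutPlane_of_im_ne_zero him)

theorem tendstoUniformlyOn_psiComp_nome :
    TendstoUniformlyOn psiComp nome atTop oneCutPlane :=
  tendstoUniformlyOn_psiComp.congr_right nome_eqOn_psiLim.symm

theorem nome_differentiableOn : DifferentiableOn ℂ nome oneCutPlane :=
  psiLim_differentiableOn.congr nome_eqOn_psiLim

/-! ### Logarithms of nonvanishing functions -/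

theorem exists_log_on_ball {f : ℂ → ℂ} {c : ℂ} {r : ℝ}
    (hf : DifferentiableOn ℂ f (Metric.ball c r)) (h0 : ∀ z ∈ Metric.ball c r, f z ≠ 0)
    {p y : ℂ} (hp : p ∈ Metric.ball c r) (hy : Complex.exp y = f p) :
    ∃ L : ℂ → ℂ, DifferentiableOn ℂ L (Metric.ball c r) ∧ L p = y ∧
      ∀ z ∈ Metric.ball c r, Complex.exp (L z) = f z := by
  have hd : DifferentiableOn ℂ (fun z => deriv f z / f z) (Metric.ball c r) :=
    (hf.deriv Metric.isOpen_ball).div hf h0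
  obtain ⟨L, hLp, hL⟩ := hd.isExactOn_ball.with_val_at p y
  have hquot : ∀ z ∈ Metric.ball c r,
      HasDerivAt (fun z => Complex.exp (-L z) * f z) 0 z := fun z hz => by
    have hfz := (hf.differentiableAt (Metric.isOpen_ball.mem_nhds hz)).hasDerivAt
    refine ((hL z hz).neg.cexp.mul hfz).congr_deriv ?_
    have := h0 z hz
    field_simp
    ring
  refine ⟨L, fun z hz => (hL z hz).differentiableAt.differentiableWithinAt, hLp, fun z hz => ?_⟩
  have hconst := Metric.isOpen_ball.is_const_of_deriv_eq_zero (convex_ball c r).isPreconnected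
    (fun z hz => (hquot z hz).differentiableAt.differentiableWithinAt)
    (fun z hz => (hquot z hz).deriv) hz hp
  rw [hLp, ← hy, ← Complex.exp_add, neg_add_cancel, Complex.exp_zero, Complex.exp_neg,
    inv_mul_eq_one₀ (Complex.exp_ne_zero _)] at hconst
  exact hconst

theorem exists_analyticAt_log {f : ℂ → ℂ} {p y : ℂ} (hf : AnalyticAt ℂ f p) (h0 : f p ≠ 0)
    (hy : Complex.exp y = f p) :
    ∃ L : ℂ → ℂ, AnalyticAt ℂ L p ∧ L p = y ∧ ∀ᶠ z in 𝓝 p, Complex.exp (L z) = f z := by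
  obtain ⟨r, hr, hball⟩ := Metric.eventually_nhds_iff_ball.1
    (hf.eventually_analyticAt.and (hf.continuousAt.eventually_ne h0))
  obtain ⟨L, hL, hLp, hexp⟩ := exists_log_on_ball
    (fun z hz => (hball z hz).1.differentiableAt.differentiableWithinAt)
    (fun z hz => (hball z hz).2) (Metric.mem_ball_self hr) hy
  exact ⟨L, hL.analyticAt (Metric.ball_mem_nhds p hr), hLp,
    Metric.eventually_nhds_iff_ball.2 ⟨r, hr, hexp⟩⟩

section ExpEq

variable {X : Type*} [TopologicalSpace X] {u v : X → ℂ} {p : X}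

theorem eventually_sub_eq_sub_of_exp_eq (hu : ContinuousAt u p) (hv : ContinuousAt v p)
    (h : ∀ᶠ z in 𝓝 p, Complex.exp (u z) = Complex.exp (v z)) :
    ∀ᶠ z in 𝓝 p, u z - v z = u p - v p := by
  set d : X → ℂ := fun z => u z - v z - (u p - v p)
  have him : Tendsto (fun z => (d z).im) (𝓝 p) (𝓝 0) := by
    have hd : ContinuousAt d p := (hu.sub hv).sub_const (u p - v p)
    simpa only [ContinuousAt, d, sub_self, Complex.zero_im, Function.comp_def] using
      Complex.continuous_im.continuousAt.comp hd
  filter_upwards [h, him.eventually_lt_const Real.pi_pos,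
    him.eventually_const_lt (neg_lt_zero.2 Real.pi_pos)] with z hz hlt hgt
  have hexp : Complex.exp (d z) = 1 := by
    rw [Complex.exp_sub, Complex.exp_sub, Complex.exp_sub, hz, h.self_of_nhds,
      div_self (Complex.exp_ne_zero _), div_self (Complex.exp_ne_zero _), div_one]
  rw [← sub_eq_zero]
  change d z = 0
  rw [← Complex.log_exp hgt hlt.le, hexp, Complex.log_one]

theorem eventuallyEq_of_exp_eq (hu : ContinuousAt u p) (hv : ContinuousAt v p)
    (h : ∀ᶠ z in 𝓝 p, Complex.exp (u z) = Complex.exp (v z)) (hp : u p = v p) : u =ᶠ[𝓝 p] v := by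
  filter_upwards [eventually_sub_eq_sub_of_exp_eq hu hv h] with z hz
  rwa [hp, sub_self, sub_eq_zero] at hz

end ExpEq

theorem exists_analyticAt_eq_mul_exp {G : ℂ → ℂ} (hG : AnalyticAt ℂ G 0) (h0 : G 0 = 0)
    (h' : deriv G 0 ≠ 0) :
    ∃ e : ℂ → ℂ, AnalyticAt ℂ e 0 ∧ ∀ᶠ q in 𝓝 0, G q = q * Complex.exp (e q) := by
  have hd : AnalyticAt ℂ (dslope G 0) 0 := by
    obtain ⟨p, hp⟩ := hG
    exact hp.has_fpower_series_dslope_fslope.analyticAt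
  have hd0 : dslope G 0 0 ≠ 0 := by rwa [dslope_same]
  obtain ⟨e, he, -, hexp⟩ := exists_analyticAt_log hd hd0 (Complex.exp_log hd0)
  refine ⟨e, he, hexp.mono fun q hq => ?_⟩
  have := sub_smul_dslope G 0 q
  rw [h0, sub_zero, sub_zero, smul_eq_mul] at this
  rw [hq, this]

theorem exists_analyticAt_comp_eq {f g : ℂ → ℂ} {a : ℂ} (hf : AnalyticAt ℂ f a)
    (hf' : deriv f a ≠ 0) (hg : AnalyticAt ℂ g a) :
    ∃ G : ℂ → ℂ, AnalyticAt ℂ G (f a) ∧ ∀ᶠ z in 𝓝 a, G (f z) = g z := by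
  have hs := hf.hasStrictDerivAt
  have hinv := hs.eventually_left_inverse hf'
  refine ⟨g ∘ hs.localInverse f _ a hf', ?_, hinv.mono fun z hz => congrArg g hz⟩
  refine AnalyticAt.comp ?_ (hf.analyticAt_localInverse hf')
  rwa [hinv.self_of_nhds]

theorem exp_two_mul (z : ℂ) : Complex.exp (2 * z) = Complex.exp z ^ 2 := by
  rw [← Complex.exp_nat_mul, Nat.cast_two]

theorem deriv_ne_zero_of_le_norm {f : ℂ → ℂ} {c : ℝ} (hc : 0 < c) (hf : DifferentiableAt ℂ f 0)
    (h0 : f 0 = 0) (h : ∀ᶠ z in 𝓝 (0 : ℂ), c * ‖z‖ ≤ ‖f z‖) : deriv f 0 ≠ 0 := by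
  refine norm_pos_iff.1 (hc.trans_le (ge_of_tendsto hf.hasDerivAt.tendsto_slope.norm ?_))
  filter_upwards [nhdsWithin_le_nhds h, self_mem_nhdsWithin] with z hz hz0
  rwa [slope_def_field, h0, sub_zero, sub_zero, norm_div, le_div_iff₀ (norm_pos_iff.2 hz0)]

theorem tendsto_pow_nhds_zero {k : ℕ} (hk : k ≠ 0) :
    Tendsto (fun q : ℂ => q ^ k) (𝓝 0) (𝓝 0) :=
  (continuous_pow k).tendsto' 0 0 (zero_pow hk)

/-! ### The compositions as functions of the nome, near the origin -/

theorem zero_mem_oneCutPlane : (0 : ℂ) ∈ oneCutPlane :=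
  mem_oneCutPlane_of_norm_lt_one (norm_zero.trans_lt one_pos)

theorem nome_analyticAt {ω : ℂ} (h : ω ∈ oneCutPlane) : AnalyticAt ℂ nome ω :=
  nome_differentiableOn.analyticAt (isOpen_oneCutPlane.mem_nhds h)

theorem psiOne_analyticAt {ω : ℂ} (h : ω ∈ oneCutPlane) : AnalyticAt ℂ psiOne ω :=
  psiOne_differentiableOn.analyticAt (isOpen_oneCutPlane.mem_nhds h)

theorem tendsto_psiOne : Tendsto psiOne (𝓝 0) (𝓝 0) := by
  simpa only [psiOne_zero] using (psiOne_analyticAt zero_mem_oneCutPlane).continuousAt.tendsto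

theorem tendsto_psiOne_sq : Tendsto (fun m => psiOne m ^ 2) (𝓝 0) (𝓝 0) :=
  (tendsto_pow_nhds_zero two_ne_zero).comp tendsto_psiOne

theorem psiOne_eq_div (ω : ℂ) : psiOne ω = ω / (1 + csqrt (1 - ω)) ^ 2 := by
  have hne := one_add_csqrt_ne_zero (1 - ω)
  rw [psiOne, div_eq_div_iff hne (pow_ne_zero 2 hne)]
  linear_combination -(1 + csqrt (1 - ω)) * csqrt_sq (1 - ω)

theorem one_add_psiOne (ω : ℂ) : 1 + psiOne ω = 2 / (1 + csqrt (1 - ω)) := by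
  have hne := one_add_csqrt_ne_zero (1 - ω)
  rw [psiOne]
  field_simp
  ring

theorem deriv_psiOne_ne_zero : deriv psiOne 0 ≠ 0 := by
  refine deriv_ne_zero_of_le_norm (c := 1 / 9) (by norm_num)
    (psiOne_analyticAt zero_mem_oneCutPlane).differentiableAt psiOne_zero ?_
  filter_upwards [Metric.ball_mem_nhds (0 : ℂ) one_pos] with z hz
  linarith [le_norm_psiOne (mem_ball_zero_iff.1 hz).le]

theorem deriv_nome_ne_zero : deriv nome 0 ≠ 0 := by
  refine deriv_ne_zero_of_le_norm (c := 1 / 81) (by norm_num)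
    (nome_analyticAt zero_mem_oneCutPlane).differentiableAt nome_zero ?_
  filter_upwards [Metric.ball_mem_nhds (0 : ℂ) one_pos] with z hz
  have hz := mem_ball_zero_iff.1 hz
  have hm := mem_oneCutPlane_of_norm_lt_one hz
  rw [nome_eqOn_psiLim hm]
  linarith [le_norm_psiOne hz.le, le_norm_psiLim hm]

theorem eventually_nome {p : ℂ → Prop} : (∀ᶠ m in 𝓝 0, p (nome m)) ↔ ∀ᶠ q in 𝓝 0, p q := by
  have hmap := (nome_analyticAt zero_mem_oneCutPlane).hasStrictDerivAt.map_nhds_eq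
    deriv_nome_ne_zero
  rw [nome_zero] at hmap
  conv_rhs => rw [← hmap, eventually_map]

theorem nome_sq {ω : ℂ} (h : ω ∈ oneCutPlane) : nome ω ^ 2 = nome (psiOne ω ^ 2) := by
  rw [nome_eqOn_psiLim h, psiLim_sq h,
    nome_eqOn_psiLim (pow_mem_oneCutPlane (norm_psiOne_lt_one h) two_ne_zero)]

theorem csqrt_one : csqrt 1 = 1 := by simp [csqrt]

theorem continuousAt_one_add_csqrt_one_sub :
    ContinuousAt (fun u => 1 + csqrt (1 - u)) 0 := by
  have hslit : (1 - 0 : ℂ) ∈ Complex.slitPlane := by simp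
  exact ((continuousAt_const.sub continuousAt_id).cpow continuousAt_const hslit).const_add 1

/-- The germ at `0` of `e` is a logarithm of `ψ₁ / nome` expressed as a function of the nome. -/
structure IsNomeLog (e : ℂ → ℂ) : Prop where
  analyticAt : AnalyticAt ℂ e 0
  psiOne_eq : ∀ᶠ m in 𝓝 0, psiOne m = nome m * Complex.exp (e (nome m))

namespace IsNomeLog

variable {e e' : ℂ → ℂ}

theorem congr (he : IsNomeLog e) (h : e' =ᶠ[𝓝 0] e) : IsNomeLog e' where
  analyticAt := he.analyticAt.congr h.symm
  psiOne_eq := by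
    filter_upwards [he.psiOne_eq, eventually_nome.2 h] with m hm hem
    rw [hm, hem]

theorem continuousAt_mul_exp_sq (he : IsNomeLog e) :
    ContinuousAt (fun q => (q * Complex.exp (e q)) ^ 2) 0 :=
  (continuousAt_id.mul he.analyticAt.continuousAt.cexp).pow 2

theorem continuousAt_apply_sq (he : IsNomeLog e) : ContinuousAt (fun q => e (q ^ 2)) 0 :=
  he.analyticAt.continuousAt.comp_of_eq (continuous_pow 2).continuousAt (zero_pow two_ne_zero)

theorem continuousAt_one_add_csqrt (he : IsNomeLog e) :
    ContinuousAt (fun q => 1 + csqrt (1 - (q * Complex.exp (e q)) ^ 2)) 0 :=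
  continuousAt_one_add_csqrt_one_sub.comp_of_eq he.continuousAt_mul_exp_sq (by simp)

theorem psiOne_mul_exp_sq (he : IsNomeLog e) :
    ∀ᶠ q in 𝓝 0, psiOne ((q * Complex.exp (e q)) ^ 2) = q ^ 2 * Complex.exp (e (q ^ 2)) := by
  rw [← eventually_nome]
  filter_upwards [he.psiOne_eq, tendsto_psiOne_sq.eventually he.psiOne_eq,
    isOpen_oneCutPlane.mem_nhds zero_mem_oneCutPlane] with m hm hm2 hmem
  rw [← hm, hm2, nome_sq hmem]

theorem exp_sq_eq (he : IsNomeLog e) :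
    ∀ᶠ q in 𝓝 0, Complex.exp (e q) ^ 2 =
      Complex.exp (e (q ^ 2)) * (1 + csqrt (1 - (q * Complex.exp (e q)) ^ 2)) ^ 2 := by
  refine (ContinuousAt.eventuallyEq_nhds_iff_eventuallyEq_nhdsNE
    (he.analyticAt.continuousAt.cexp.pow 2)
    (he.continuousAt_apply_sq.cexp.mul (he.continuousAt_one_add_csqrt.pow 2))).1 ?_
  filter_upwards [nhdsWithin_le_nhds he.psiOne_mul_exp_sq, self_mem_nhdsWithin] with q hq hq0
  refine mul_left_cancel₀ (pow_ne_zero 2 hq0) ?_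
  rw [psiOne_eq_div, div_eq_iff (pow_ne_zero 2 (one_add_csqrt_ne_zero _)), mul_pow] at hq
  simpa only [mul_pow, mul_assoc, Pi.pow_apply, Pi.mul_apply] using hq

theorem exp_apply_zero (he : IsNomeLog e) : Complex.exp (e 0) = 4 := by
  have h := he.exp_sq_eq.self_of_nhds
  rw [zero_mul, zero_pow two_ne_zero, sub_zero, csqrt_one, sq] at h
  rw [mul_left_cancel₀ (Complex.exp_ne_zero _) h]
  norm_num

theorem apply_sq (he : IsNomeLog e) (h0 : e 0 = 2 * Complex.log 2) :
    ∀ᶠ q in 𝓝 0, e (q ^ 2) =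
      2 * (e q - Complex.log (1 + csqrt (1 - (q * Complex.exp (e q)) ^ 2))) := by
  refine eventuallyEq_of_exp_eq he.continuousAt_apply_sq
    ((he.analyticAt.continuousAt.sub (he.continuousAt_one_add_csqrt.clog
      (Or.inl (one_add_csqrt_re_pos _)))).const_mul 2) ?_ ?_
  · filter_upwards [he.exp_sq_eq] with q hq
    have hc := one_add_csqrt_ne_zero (1 - (q * Complex.exp (e q)) ^ 2)
    rw [exp_two_mul, Complex.exp_sub, Complex.exp_log hc, div_pow, hq,
      mul_div_cancel_right₀ _ (pow_ne_zero 2 hc)]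
  · rw [zero_mul, zero_pow two_ne_zero, sub_zero, csqrt_one, one_add_one_eq_two, h0]
    ring

theorem psiComp_eq (he : IsNomeLog e) (h0 : e 0 = 2 * Complex.log 2) (n : ℕ) :
    ∀ᶠ m in 𝓝 0, psiComp n m = nome m * Complex.exp (e (nome m ^ 2 ^ n) / 2 ^ n) := by
  induction n with
  | zero => simpa [psiComp] using he.psiOne_eq
  | succ n ih =>
    have ht := (tendsto_pow_nhds_zero (pow_ne_zero n two_ne_zero)).eventually (he.apply_sq h0)
    filter_upwards [ih, eventually_nome.2 ht] with m hm hQ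
    set Q := nome m ^ 2 ^ n with hQdef
    have hpow : psiComp n m ^ 2 ^ (n + 1) = (Q * Complex.exp (e Q)) ^ 2 := by
      rw [pow_succ, pow_mul, hm, mul_pow, ← Complex.exp_nat_mul, Nat.cast_pow, Nat.cast_two,
        mul_div_cancel₀ _ (pow_ne_zero n two_ne_zero)]
    calc psiComp (n + 1) m = psi (2 ^ (n + 1)) (psiComp n m) := rfl
      _ = nome m * Complex.exp (e Q / 2 ^ n + -2 / (2 ^ (n + 1) : ℕ) *
            Complex.log (1 + csqrt (1 - (Q * Complex.exp (e Q)) ^ 2))) := by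
        rw [psi_eq_mul_exp, hpow, hm, Complex.exp_add, mul_assoc]
      _ = nome m * Complex.exp (e (Q ^ 2) / 2 ^ (n + 1)) := by
        rw [hQ]
        push_cast
        congr 2
        field_simp
        ring
      _ = nome m * Complex.exp (e (nome m ^ 2 ^ (n + 1)) / 2 ^ (n + 1)) := by
        rw [hQdef, ← pow_mul, ← pow_succ]

end IsNomeLog

theorem exists_isNomeLog : ∃ e, IsNomeLog e ∧ e 0 = 2 * Complex.log 2 := by
  obtain ⟨G, hG, hGpsi⟩ := exists_analyticAt_comp_eq (nome_analyticAt zero_mem_oneCutPlane)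
    deriv_nome_ne_zero (psiOne_analyticAt zero_mem_oneCutPlane)
  rw [nome_zero] at hG
  have hG0 : G 0 = 0 := by simpa only [nome_zero, psiOne_zero] using hGpsi.self_of_nhds
  have hG' : deriv G 0 ≠ 0 := fun h => deriv_psiOne_ne_zero <| by
    have hnome := (nome_analyticAt zero_mem_oneCutPlane).differentiableAt.hasDerivAt
    have hcomp := HasDerivAt.comp_of_eq 0 hG.differentiableAt.hasDerivAt hnome nome_zero.symm
    rw [← EventuallyEq.deriv_eq hGpsi, ← Function.comp_def, hcomp.deriv, h, zero_mul]
  obtain ⟨e, he, hGe⟩ := exists_analyticAt_eq_mul_exp hG hG0 hG'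
  have heLog : IsNomeLog e := ⟨he, by
    filter_upwards [hGpsi, eventually_nome.2 hGe] with m hm hem
    rw [← hm, hem]⟩
  refine ⟨fun q => e q - e 0 + 2 * Complex.log 2, ⟨by fun_prop, ?_⟩, by ring⟩
  filter_upwards [heLog.psiOne_eq] with m hm
  rw [hm, Complex.exp_add, Complex.exp_sub, heLog.exp_apply_zero, exp_two_mul,
    Complex.exp_log two_ne_zero]
  norm_num

/-! ### Extension to the unit disk -/

/-- `e` is holomorphic on the disk of radius `r` about `0`, and `(q exp (e q))²` omits there the
value `1`. -/
structure IsRegularOn (e : ℂ → ℂ) (r : ℝ) : Prop where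
  differentiableOn : DifferentiableOn ℂ e (Metric.ball 0 r)
  sq_ne_one : ∀ q ∈ Metric.ball (0 : ℂ) r, (q * Complex.exp (e q)) ^ 2 ≠ 1

theorem IsRegularOn.one_add_ne_zero {e : ℂ → ℂ} {r : ℝ} (he : IsRegularOn e r) {q : ℂ}
    (hq : q ∈ Metric.ball 0 r) : 1 + q * Complex.exp (e q) ≠ 0 := fun h =>
  he.sq_ne_one q hq (by rw [← neg_eq_of_add_eq_zero_right h]; norm_num)

theorem IsRegularOn.mono {e : ℂ → ℂ} {r r' : ℝ} (he : IsRegularOn e r) (h : r' ≤ r) :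
    IsRegularOn e r' :=
  ⟨he.differentiableOn.mono (Metric.ball_subset_ball h),
    fun q hq => he.sq_ne_one q (Metric.ball_subset_ball h hq)⟩

theorem exists_isRegularOn_of_analyticAt {e : ℂ → ℂ} (he : AnalyticAt ℂ e 0) :
    ∃ r > 0, IsRegularOn e r := by
  have hne : ∀ᶠ q in 𝓝 0, (q * Complex.exp (e q)) ^ 2 ≠ 1 :=
    ((continuousAt_id.mul he.continuousAt.cexp).pow 2).eventually_ne (by simp)
  obtain ⟨r, hr, hball⟩ := Metric.eventually_nhds_iff_ball.1 (he.eventually_analyticAt.and hne)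
  exact ⟨r, hr, fun q hq => (hball q hq).1.differentiableAt.differentiableWithinAt,
    fun q hq => (hball q hq).2⟩

theorem sq_mem_ball {q : ℂ} {ρ : ℝ} (hq : q ∈ Metric.ball 0 ρ) :
    q ^ 2 ∈ Metric.ball (0 : ℂ) (ρ ^ 2) := by
  rw [mem_ball_zero_iff] at hq ⊢
  rw [norm_pow]
  gcongr

theorem IsRegularOn.mul_exp_sq_ne_one {e : ℂ → ℂ} {r : ℝ} (he : IsRegularOn e r) {q y : ℂ}
    (hq : q ^ 2 ∈ Metric.ball 0 r)
    (hy : Complex.exp y ^ 2 * (1 + q ^ 2 * Complex.exp (e (q ^ 2))) ^ 2 =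
      4 * Complex.exp (e (q ^ 2))) :
    (q * Complex.exp y) ^ 2 ≠ 1 := by
  intro h1
  set w := q ^ 2 * Complex.exp (e (q ^ 2)) with hw
  have hsq : (w - 1) ^ 2 = 0 := by
    linear_combination q ^ 2 * hy - (1 + w) ^ 2 * h1 - 4 * hw
  refine he.sq_ne_one _ hq ?_
  rw [← hw, sub_eq_zero.1 ((pow_eq_zero_iff two_ne_zero).1 hsq), one_pow]

/- If `G q = q exp (e q)`, then `psiOne (G q ^ 2) = G (q ^ 2)`, that is,
`G q ^ 2 = 4 G (q ^ 2) / (1 + G (q ^ 2)) ^ 2`; taking half the logarithm of the right-hand side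
extends `e` from the disk of radius `ρ²` to that of radius `ρ`. -/
theorem IsNomeLog.exists_isRegularOn_of_sq {e : ℂ → ℂ} (he : IsNomeLog e)
    (h0 : e 0 = 2 * Complex.log 2) {ρ : ℝ} (hρ : 0 < ρ) (hr : IsRegularOn e (ρ ^ 2)) :
    ∃ e', e' =ᶠ[𝓝 0] e ∧ IsRegularOn e' ρ := by
  obtain ⟨L, hLd, hL0, hL⟩ := exists_log_on_ball (f := fun q => 1 + q * Complex.exp (e q))
    ((differentiableOn_id.mul hr.differentiableOn.cexp).const_add 1)
    (fun q hq => hr.one_add_ne_zero hq) (Metric.mem_ball_self (pow_pos hρ 2)) (y := 0) (by simp)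
  set e' : ℂ → ℂ := fun q => Complex.log 2 + e (q ^ 2) / 2 - L (q ^ 2) with he'
  have he'd : DifferentiableOn ℂ e' (Metric.ball 0 ρ) := by
    have hmaps : Set.MapsTo (fun q : ℂ => q ^ 2) (Metric.ball 0 ρ) (Metric.ball 0 (ρ ^ 2)) :=
      fun _ => sq_mem_ball
    have hsq : DifferentiableOn ℂ (fun q : ℂ => q ^ 2) (Metric.ball 0 ρ) := by fun_prop
    exact (((hr.differentiableOn.comp hsq hmaps).div_const 2).const_add _).sub
      (hLd.comp hsq hmaps)
  have hρball := Metric.ball_mem_nhds (0 : ℂ) hρ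
  refine ⟨e', eventuallyEq_of_exp_eq (he'd.differentiableAt hρball).continuousAt
    he.analyticAt.continuousAt ?_ ?_, he'd, fun q hq => hr.mul_exp_sq_ne_one (sq_mem_ball hq) ?_⟩
  · filter_upwards [he.apply_sq h0, he.psiOne_mul_exp_sq, hρball] with q hfun hpsi hq
    have hc := one_add_csqrt_ne_zero (1 - (q * Complex.exp (e q)) ^ 2)
    have hexp := hL _ (sq_mem_ball hq)
    rw [← hpsi, one_add_psiOne] at hexp
    simp only [he']
    rw [hfun, mul_div_cancel_left₀ _ two_ne_zero, Complex.exp_sub, Complex.exp_add,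
      Complex.exp_log two_ne_zero, Complex.exp_sub, Complex.exp_log hc, hexp]
    generalize 1 + csqrt (1 - (q * Complex.exp (e q)) ^ 2) = c at hc ⊢
    field_simp
  · simp only [he', zero_pow two_ne_zero, h0, hL0]
    ring
  · have h2 : 2 * e' q = 2 * Complex.log 2 + e (q ^ 2) - 2 * L (q ^ 2) := by
      simp only [he']
      ring
    have hne := hr.one_add_ne_zero (sq_mem_ball hq)
    rw [← exp_two_mul, h2, Complex.exp_sub, Complex.exp_add, exp_two_mul, exp_two_mul,
      Complex.exp_log two_ne_zero, hL _ (sq_mem_ball hq)]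
    field_simp
    norm_num

theorem IsNomeLog.exists_isRegularOn_of_pow {e : ℂ → ℂ} (he : IsNomeLog e)
    (h0 : e 0 = 2 * Complex.log 2) (n : ℕ) {ρ : ℝ} (hρ : 0 < ρ)
    (hr : IsRegularOn e (ρ ^ 2 ^ n)) : ∃ e', e' =ᶠ[𝓝 0] e ∧ IsRegularOn e' ρ := by
  induction n generalizing ρ with
  | zero => exact ⟨e, EventuallyEq.rfl, by rwa [pow_zero, pow_one] at hr⟩
  | succ n ih =>
    rw [pow_succ', pow_mul] at hr
    obtain ⟨e', he', hr'⟩ := ih (pow_pos hρ 2) hr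
    obtain ⟨e'', he'', hr''⟩ :=
      (he.congr he').exists_isRegularOn_of_sq (he'.self_of_nhds.trans h0) hρ hr'
    exact ⟨e'', he''.trans he', hr''⟩

theorem exists_psiComp_eq_nome_mul_exp {ρ : ℝ} (hρ : 0 < ρ) (hρ1 : ρ < 1) :
    ∃ e : ℂ → ℂ, DifferentiableOn ℂ e (Metric.ball 0 ρ) ∧
      ∀ n, ∀ᶠ m in 𝓝 0, psiComp n m = nome m * Complex.exp (e (nome m ^ 2 ^ n) / 2 ^ n) := by
  obtain ⟨e, he, h0⟩ := exists_isNomeLog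
  obtain ⟨r, hr, hreg⟩ := exists_isRegularOn_of_analyticAt he.analyticAt
  have hpow : Tendsto (fun n : ℕ => ρ ^ 2 ^ n) atTop (𝓝 0) :=
    (tendsto_pow_atTop_nhds_zero_of_lt_one hρ.le hρ1).comp
      (tendsto_pow_atTop_atTop_of_one_lt one_lt_two)
  obtain ⟨n, hn⟩ := (hpow.eventually_lt_const hr).exists
  obtain ⟨e', he', hreg'⟩ := he.exists_isRegularOn_of_pow h0 n hρ (hreg.mono hn.le)
  exact ⟨e', hreg'.differentiableOn,
    (he.congr he').psiComp_eq (he'.self_of_nhds.trans h0)⟩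

/-! ### Branches of the nome -/

theorem norm_nome_lt_one {ω : ℂ} (h : ω ∈ oneCutPlane) : ‖nome ω‖ < 1 := by
  rw [nome_eqOn_psiLim h]
  exact norm_psiLim_lt_one h

theorem nome_ne_zero {ω : ℂ} (h : ω ∈ oneCutPlane) (h0 : ω ≠ 0) : nome ω ≠ 0 := by
  rw [nome_eqOn_psiLim h]
  exact psiLim_ne_zero h h0

/-- `w` is, near `p`, a holomorphic branch of `-log nome`. -/
structure IsNegLogNome (w : ℂ → ℂ) (p : ℂ) : Prop where
  analyticAt : AnalyticAt ℂ w p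
  exp_neg_eq : ∀ᶠ z in 𝓝 p, Complex.exp (-w z) = nome z

theorem IsNegLogNome.re_pos {w : ℂ → ℂ} {p : ℂ} (hw : IsNegLogNome w p) (hp : p ∈ oneCutPlane) :
    0 < (w p).re := by
  have h := norm_nome_lt_one hp
  rwa [← hw.exp_neg_eq.self_of_nhds, Complex.norm_exp, Real.exp_lt_one_iff, Complex.neg_re,
    neg_lt_zero] at h

theorem isNegLogNome_nomeExponent {p : ℂ} (hp : p ∈ twoCutPlane) :
    IsNegLogNome nomeExponent p where
  analyticAt := nomeExponent_differentiableOn.analyticAt (isOpen_twoCutPlane.mem_nhds hp)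
  exp_neg_eq := by
    filter_upwards [isOpen_twoCutPlane.mem_nhds hp] with z hz
    exact (nome_eq_exp (ne_zero_of_mem_twoCutPlane hz)).symm

theorem exists_isNegLogNome_on_ball {c : ℂ} {r : ℝ} (hr : 0 < r)
    (hball : Metric.ball c r ⊆ oneCutPlane \ {0}) :
    ∃ w, ∀ z ∈ Metric.ball c r, IsNegLogNome w z := by
  have hne : ∀ z ∈ Metric.ball c r, nome z ≠ 0 := fun z hz =>
    nome_ne_zero (hball hz).1 (hball hz).2
  have hc := Metric.mem_ball_self (x := c) hr
  obtain ⟨L, hLd, -, hL⟩ := exists_log_on_ball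
    (nome_differentiableOn.mono fun z hz => (hball hz).1) hne hc (Complex.exp_log (hne c hc))
  refine ⟨fun z => -L z, fun z hz => ⟨?_, ?_⟩⟩
  · exact (hLd.analyticAt (Metric.isOpen_ball.mem_nhds hz)).neg
  · filter_upwards [Metric.isOpen_ball.mem_nhds hz] with y hy
    rw [neg_neg, hL y hy]

theorem exists_ball_subset_oneCutPlane_diff_zero {c : ℂ} (hc : c ∈ oneCutPlane) (h0 : c ≠ 0) :
    ∃ r > 0, Metric.ball c r ⊆ oneCutPlane \ {0} :=
  Metric.isOpen_iff.1 (isOpen_oneCutPlane.sdiff isClosed_singleton) c ⟨hc, h0⟩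

/-- `T` is a holomorphic map from the right half-plane to the unit disk. -/
structure IsHalfPlaneToDisk (T : ℂ → ℂ) : Prop where
  differentiableOn : DifferentiableOn ℂ T {z | 0 < z.re}
  norm_lt_one : ∀ z, 0 < z.re → ‖T z‖ < 1

theorem IsHalfPlaneToDisk.comp {T φ : ℂ → ℂ} (hT : IsHalfPlaneToDisk T)
    (hφ : DifferentiableOn ℂ φ {z | 0 < z.re}) (hre : ∀ z, 0 < z.re → 0 < (φ z).re) :
    IsHalfPlaneToDisk fun z => T (φ z) :=
  ⟨hT.differentiableOn.comp hφ hre, fun z hz => hT.norm_lt_one _ (hre z hz)⟩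

theorem isHalfPlaneToDisk_exp_neg : IsHalfPlaneToDisk fun z => Complex.exp (-z) :=
  ⟨by fun_prop, fun z hz => by
    rwa [Complex.norm_exp, Real.exp_lt_one_iff, Complex.neg_re, neg_lt_zero]⟩

theorem ofReal_div_re_pos {a : ℝ} (ha : 0 < a) {z : ℂ} (hz : 0 < z.re) :
    0 < ((a : ℂ) / z).re := by
  have hz0 : z ≠ 0 := fun h => hz.ne' (by rw [h, Complex.zero_re])
  rw [div_eq_mul_inv, Complex.re_ofReal_mul, Complex.inv_re]
  exact mul_pos ha (div_pos hz (Complex.normSq_pos.2 hz0))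

/-- `f` is, near the point `p` of the one-cut plane, a holomorphic function from the right
half-plane to the unit disk applied to a branch of `-log nome`. Analytic continuation of the nome
around `0` changes the branch, and continuation around `1` the function of it. -/
def IsLogBranch (f : ℂ → ℂ) (p : ℂ) : Prop :=
  p ∈ oneCutPlane ∧ ∃ T w, IsHalfPlaneToDisk T ∧ IsNegLogNome w p ∧ f =ᶠ[𝓝 p] T ∘ w

namespace IsLogBranch

variable {f : ℂ → ℂ} {p : ℂ}

theorem analyticAt (h : IsLogBranch f p) : AnalyticAt ℂ f p := by
  obtain ⟨hp, T, w, hT, hw, hf⟩ := h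
  have hopen : IsOpen {z : ℂ | 0 < z.re} := isOpen_lt continuous_const Complex.continuous_re
  exact ((hT.differentiableOn.analyticAt (hopen.mem_nhds (hw.re_pos hp))).comp
    hw.analyticAt).congr hf.symm

theorem norm_lt_one (h : IsLogBranch f p) : ‖f p‖ < 1 := by
  obtain ⟨hp, T, w, hT, hw, hf⟩ := h
  rw [hf.self_of_nhds]
  exact hT.norm_lt_one _ (hw.re_pos hp)

/- Two branches of `-log nome` differ by a purely imaginary constant, which `T` absorbs. -/
theorem exists_eventuallyEq_comp (h : IsLogBranch f p) {w' : ℂ → ℂ} (hw' : IsNegLogNome w' p) :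
    ∃ T, IsHalfPlaneToDisk T ∧ f =ᶠ[𝓝 p] T ∘ w' := by
  obtain ⟨-, T, w, hT, hw, hf⟩ := h
  set d : ℂ := w p - w' p
  have hexp : ∀ᶠ z in 𝓝 p, Complex.exp (w z) = Complex.exp (w' z) := by
    filter_upwards [hw.exp_neg_eq, hw'.exp_neg_eq] with z hz hz'
    rw [← inv_inj, ← Complex.exp_neg, ← Complex.exp_neg, hz, hz']
  have hd : d.re = 0 := by
    have hnorm := congrArg norm hexp.self_of_nhds
    rw [Complex.norm_exp, Complex.norm_exp, Real.exp_eq_exp] at hnorm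
    rw [Complex.sub_re, hnorm, sub_self]
  refine ⟨fun u => T (u + d), hT.comp (by fun_prop) fun z hz => ?_, ?_⟩
  · rwa [Complex.add_re, hd, add_zero]
  · filter_upwards [hf, eventually_sub_eq_sub_of_exp_eq hw.analyticAt.continuousAt
      hw'.analyticAt.continuousAt hexp] with z hfz hz
    exact hfz.trans (congrArg T (sub_eq_iff_eq_add'.1 hz))

theorem one_sub (h : IsLogBranch f p) (hp : 1 - p ∈ oneCutPlane) :
    IsLogBranch (fun z => f (1 - z)) (1 - p) := by
  have hp2 : p ∈ twoCutPlane := ⟨one_sub_mem_oneCutPlane_iff.1 hp, h.1⟩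
  have hp2' : 1 - p ∈ twoCutPlane := one_sub_mem_twoCutPlane hp2
  obtain ⟨T, hT, hf⟩ := h.exists_eventuallyEq_comp (isNegLogNome_nomeExponent hp2)
  refine ⟨hp, fun u => T ((Real.pi ^ 2 : ℝ) / u), nomeExponent, hT.comp ?_ fun z hz =>
    ofReal_div_re_pos (by positivity) hz, isNegLogNome_nomeExponent hp2', ?_⟩
  · exact (differentiableOn_const _).div differentiableOn_id
      fun z (hz : 0 < z.re) h => hz.ne' (by rw [h, Complex.zero_re])
  · have ht : Tendsto (fun z : ℂ => 1 - z) (𝓝 (1 - p)) (𝓝 p) :=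
      (continuous_const.sub continuous_id).tendsto' _ _ (sub_sub_cancel 1 p)
    filter_upwards [ht.eventually hf, isOpen_twoCutPlane.mem_nhds hp2'] with z hz hz2
    rw [hz, Function.comp_apply, Function.comp_apply, nomeExponent_one_sub hz2]
    push_cast
    rfl

end IsLogBranch

theorem isLogBranch_nome {p : ℂ} (hp : p ∈ oneCutPlane) (h0 : p ≠ 0) : IsLogBranch nome p := by
  obtain ⟨r, hr, hball⟩ := exists_ball_subset_oneCutPlane_diff_zero hp h0
  obtain ⟨w, hw⟩ := exists_isNegLogNome_on_ball hr hball
  have hwp := hw p (Metric.mem_ball_self hr)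
  exact ⟨hp, _, w, isHalfPlaneToDisk_exp_neg, hwp, hwp.exp_neg_eq.mono fun _ hz => hz.symm⟩

/-- The form, near `p`, of the germs that arise from the nome by analytic continuation: the
reflection `ω ↦ 1 - ω` exchanges the two singular points and the cuts issuing from them. -/
def IsNomeBranch (f : ℂ → ℂ) (p : ℂ) : Prop :=
  IsLogBranch f p ∨ IsLogBranch (fun z => f (1 - z)) (1 - p)

namespace IsNomeBranch

variable {f : ℂ → ℂ} {p : ℂ}

theorem analyticAt (h : IsNomeBranch f p) : AnalyticAt ℂ f p := by
  rcases h with h | h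
  · exact h.analyticAt
  · have hsub : AnalyticAt ℂ (fun z : ℂ => 1 - z) p := by fun_prop
    simpa only [Function.comp_def, sub_sub_cancel] using h.analyticAt.comp hsub

theorem norm_lt_one (h : IsNomeBranch f p) : ‖f p‖ < 1 := by
  rcases h with h | h
  · exact h.norm_lt_one
  · simpa only [sub_sub_cancel] using h.norm_lt_one

theorem one_sub (h : IsNomeBranch f p) : IsNomeBranch (fun z => f (1 - z)) (1 - p) := by
  rcases h with h | h
  · exact Or.inr (by simpa only [sub_sub_cancel] using h)
  · exact Or.inl h

theorem isLogBranch (h : IsNomeBranch f p) (hp : p ∈ oneCutPlane) : IsLogBranch f p := by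
  rcases h with h | h
  · exact h
  · simpa only [sub_sub_cancel] using h.one_sub (by rwa [sub_sub_cancel])

end IsNomeBranch

/-- Every germ with the property `P` at a point of `U` is the germ of one function that has the
property `P` at all points of `U`. -/
def GermsExtendOn (P : (ℂ → ℂ) → ℂ → Prop) (U : Set ℂ) : Prop :=
  ∀ p ∈ U, ∀ f, P f p → ∃ g : ℂ → ℂ, g =ᶠ[𝓝 p] f ∧ ∀ z ∈ U, P g z

theorem germsExtendOn_isNomeBranch_ball {c : ℂ} {r : ℝ} (hr : 0 < r)
    (hball : Metric.ball c r ⊆ oneCutPlane \ {0}) :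
    GermsExtendOn IsNomeBranch (Metric.ball c r) := by
  obtain ⟨w, hw⟩ := exists_isNegLogNome_on_ball hr hball
  intro p hp f hf
  obtain ⟨T, hT, hfT⟩ := (hf.isLogBranch (hball hp).1).exists_eventuallyEq_comp (hw p hp)
  exact ⟨T ∘ w, hfT.symm, fun z hz =>
    Or.inl ⟨(hball hz).1, T, w, hT, hw z hz, EventuallyEq.rfl⟩⟩

theorem GermsExtendOn.preimage_one_sub {U : Set ℂ} (h : GermsExtendOn IsNomeBranch U) :
    GermsExtendOn IsNomeBranch ((fun z => 1 - z) ⁻¹' U) := by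
  intro p hp f hf
  obtain ⟨g, hg, hgU⟩ := h (1 - p) hp _ hf.one_sub
  refine ⟨fun z => g (1 - z), ?_, fun z hz => ?_⟩
  · have ht : Tendsto (fun z : ℂ => 1 - z) (𝓝 p) (𝓝 (1 - p)) :=
      (continuous_const.sub continuous_id).tendsto p
    filter_upwards [ht.eventually hg] with z hz
    rw [hz, sub_sub_cancel]
  · simpa only [sub_sub_cancel] using (hgU (1 - z) hz).one_sub

theorem mem_oneCutPlane_or_one_sub_mem (c : ℂ) : c ∈ oneCutPlane ∨ 1 - c ∈ oneCutPlane := by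
  rw [mem_oneCutPlane_iff, one_sub_mem_oneCutPlane_iff, Complex.mem_slitPlane_iff,
    Complex.mem_slitPlane_iff, Complex.sub_re, Complex.one_re]
  rcases lt_or_ge 0 c.re with hc | hc
  · exact Or.inr (Or.inl hc)
  · exact Or.inl (Or.inl (by linarith))

theorem exists_germsExtendOn_isNomeBranch {c : ℂ} (h0 : c ≠ 0) (h1 : c ≠ 1) :
    ∃ U ∈ 𝓝 c, GermsExtendOn IsNomeBranch U := by
  rcases mem_oneCutPlane_or_one_sub_mem c with hc | hc
  · obtain ⟨r, hr, hball⟩ := exists_ball_subset_oneCutPlane_diff_zero hc h0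
    exact ⟨_, Metric.ball_mem_nhds c hr, germsExtendOn_isNomeBranch_ball hr hball⟩
  · obtain ⟨r, hr, hball⟩ := exists_ball_subset_oneCutPlane_diff_zero hc (sub_ne_zero.2 h1.symm)
    exact ⟨_, (continuous_const.sub continuous_id).continuousAt.preimage_mem_nhds
      (Metric.ball_mem_nhds (1 - c) hr),
      (germsExtendOn_isNomeBranch_ball hr hball).preimage_one_sub⟩

/-! ### Continuation along curves -/

open unitInterval

/-- `F` continues the germ of `f` at `γ 0` along the part of `γ` up to the time `τ`, through germs
with the property `P` after the time `0`. -/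
structure IsContinuationUpTo (P : (ℂ → ℂ) → ℂ → Prop) (γ : C(I, ℂ)) (f : ℂ → ℂ) (τ : I)
    (F : I → ℂ → ℂ) : Prop where
  start : F 0 =ᶠ[𝓝 (γ 0)] f
  germ : ∀ t ≤ τ, t ≠ 0 → P (F t) (γ t)
  coherent : ∀ t ≤ τ, ∀ᶠ s in 𝓝 t, s ≤ τ → F s =ᶠ[𝓝 (γ s)] F t

namespace IsContinuationUpTo

variable {P : (ℂ → ℂ) → ℂ → Prop} {γ : C(I, ℂ)} {f : ℂ → ℂ} {τ τ' : I} {F : I → ℂ → ℂ}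

theorem mono (h : IsContinuationUpTo P γ f τ F) (hle : τ' ≤ τ) :
    IsContinuationUpTo P γ f τ' F where
  start := h.start
  germ t ht := h.germ t (ht.trans hle)
  coherent t ht := (h.coherent t (ht.trans hle)).mono fun _ hs hsτ => hs (hsτ.trans hle)

theorem const (h : ∀ t ≤ τ, t ≠ 0 → P f (γ t)) : IsContinuationUpTo P γ f τ fun _ => f where
  start := EventuallyEq.rfl
  germ := h
  coherent _ _ := Eventually.of_forall fun _ _ => EventuallyEq.rfl

theorem exists_extension (h : IsContinuationUpTo P γ f τ F) (hτ : τ ≠ 0) (hle : τ ≤ τ')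
    {U : Set ℂ} (hU : GermsExtendOn P U) (hγ : Set.MapsTo γ (Set.Icc τ τ') U) :
    ∃ F', IsContinuationUpTo P γ f τ' F' := by
  classical
  obtain ⟨g, hg, hgP⟩ := hU (γ τ) (hγ ⟨le_rfl, hle⟩) (F τ) (h.germ τ le_rfl hτ)
  refine ⟨fun s => if s ≤ τ then F s else g, ?_, fun t ht ht0 => ?_, fun t _ => ?_⟩
  · simpa only [zero_le, if_true] using h.start
  · by_cases htτ : t ≤ τ
    · simpa only [htτ, if_true] using h.germ t htτ ht0
    · simpa only [htτ, if_false] using hgP (γ t) (hγ ⟨(not_le.1 htτ).le, ht⟩)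
  · rcases lt_trichotomy t τ with hlt | rfl | hgt
    · filter_upwards [h.coherent t hlt.le, Iio_mem_nhds hlt] with s hs hsτ _
      have hsτ : s ≤ τ := le_of_lt hsτ
      simpa only [hsτ, hlt.le, if_true] using hs hsτ
    · filter_upwards [h.coherent t le_rfl,
        (γ.continuous.tendsto t).eventually (eventually_eventually_nhds.2 hg)] with s hs hgs _
      by_cases hst : s ≤ t
      · simpa only [hst, le_refl, if_true] using hs hst
      · simp only [hst, le_refl, if_true, if_false]
        exact hgs
    · filter_upwards [Ioi_mem_nhds hgt] with s (hs : τ < s) _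
      simp only [not_le.2 hs, not_le.2 hgt, if_false]
      exact EventuallyEq.rfl

end IsContinuationUpTo

theorem exists_isContinuationUpTo {P : (ℂ → ℂ) → ℂ → Prop} {γ : C(I, ℂ)} {f : ℂ → ℂ}
    (hf : ∀ᶠ t in 𝓝 0, t ≠ 0 → P f (γ t))
    (hext : ∀ t, t ≠ 0 → ∃ U ∈ 𝓝 (γ t), GermsExtendOn P U) (τ : I) :
    ∃ F, IsContinuationUpTo P γ f τ F := by
  set Q : I → Prop := fun τ => ∃ F, IsContinuationUpTo P γ f τ F
  have hmono : ∀ {s t}, t ≤ s → Q s → Q t := fun hts ⟨F, hF⟩ => ⟨F, hF.mono hts⟩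
  have h0 : Q 0 := ⟨_, .const fun t ht ht0 => absurd (le_antisymm ht zero_le) ht0⟩
  refine PreconnectedSpace.induction₂' (fun s t => Q s → Q t) (fun s => ?_)
    ⟨fun _ _ _ h h' hs => h' (h hs)⟩ 0 τ h0
  rcases eq_or_ne s 0 with rfl | hs
  · filter_upwards [Set.ordConnectedComponent_mem_nhds.2 hf] with t ht
    refine ⟨fun _ => ⟨_, .const fun s hst => ht ?_⟩, fun _ => h0⟩
    exact Set.Icc_subset_uIcc ⟨zero_le, hst⟩
  · obtain ⟨U, hU, hUP⟩ := hext s hs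
    have hV : γ ⁻¹' U ∈ 𝓝 s := γ.continuous.continuousAt.preimage_mem_nhds hU
    filter_upwards [Set.ordConnectedComponent_mem_nhds.2 hV, isOpen_ne.mem_nhds hs] with t ht ht0
    rcases le_total s t with hst | hst
    · exact ⟨fun ⟨F, hF⟩ => hF.exists_extension hs hst hUP (Set.Icc_subset_uIcc.trans ht),
        hmono hst⟩
    · exact ⟨hmono hst,
        fun ⟨F, hF⟩ => hF.exists_extension ht0 hst hUP (Set.Icc_subset_uIcc'.trans ht)⟩

theorem exists_isContinuationAlong {P : (ℂ → ℂ) → ℂ → Prop} {γ : C(I, ℂ)} {f : ℂ → ℂ}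
    (hP : ∀ g p, P g p → AnalyticAt ℂ g p) (hf0 : AnalyticAt ℂ f (γ 0))
    (hf : ∀ᶠ t in 𝓝 0, t ≠ 0 → P f (γ t))
    (hext : ∀ t, t ≠ 0 → ∃ U ∈ 𝓝 (γ t), GermsExtendOn P U) :
    ∃ F, IsContinuationAlong γ f F ∧ ∀ t, t ≠ 0 → P (F t) (γ t) := by
  obtain ⟨F, hF⟩ := exists_isContinuationUpTo hf hext 1
  refine ⟨F, ⟨hF.start, fun t => ?_, fun t => ?_⟩, fun t => hF.germ t le_top⟩
  · rcases eq_or_ne t 0 with rfl | ht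
    · exact hf0.congr hF.start.symm
    · exact hP _ _ (hF.germ t le_top ht)
  · exact (hF.coherent t le_top).mono fun s hs => hs le_top

theorem exists_isContinuationAlong_nome {γ : C(I, ℂ)} (hγ : IsCurveFromOrigin γ) :
    ∃ Q, IsContinuationAlong γ nome Q ∧ ∀ t, ‖Q t (γ t)‖ < 1 := by
  have hcut : ∀ᶠ t in 𝓝 0, γ t ∈ oneCutPlane :=
    γ.continuous.continuousAt.eventually_mem
      (isOpen_oneCutPlane.mem_nhds (hγ.1.symm ▸ zero_mem_oneCutPlane))
  obtain ⟨Q, hQ, hbranch⟩ := exists_isContinuationAlong (P := IsNomeBranch)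
    (fun _ _ h => h.analyticAt) (hγ.1.symm ▸ nome_analyticAt zero_mem_oneCutPlane)
    (hcut.mono fun t ht ht0 => Or.inl (isLogBranch_nome ht (hγ.2 t ht0).1))
    (fun t ht => exists_germsExtendOn_isNomeBranch (hγ.2 t ht).1 (hγ.2 t ht).2)
  refine ⟨Q, hQ, fun t => ?_⟩
  rcases eq_or_ne t 0 with rfl | ht
  · rw [hQ.start.self_of_nhds, hγ.1, nome_zero, norm_zero]
    exact one_pos
  · exact (hbranch t ht).norm_lt_one

namespace IsContinuationAlong

variable {γ : C(I, ℂ)} {f g h : ℂ → ℂ} {F : I → ℂ → ℂ}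

theorem continuous_apply (hF : IsContinuationAlong γ f F) : Continuous fun t => F t (γ t) := by
  refine continuous_iff_continuousAt.2 fun t => ?_
  have hFt : ContinuousAt (fun s => F t (γ s)) t :=
    ContinuousAt.comp (g := F t) (hF.analyticAt t).continuousAt γ.continuous.continuousAt
  refine hFt.congr ?_
  filter_upwards [hF.coherent t] with s hs using hs.self_of_nhds.symm

theorem comp_left (hF : IsContinuationAlong γ f F) (hg : ∀ t, AnalyticAt ℂ g (F t (γ t)))
    (hh : ∀ᶠ z in 𝓝 (γ 0), h z = g (f z)) : IsContinuationAlong γ h fun t z => g (F t z) where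
  start := by
    filter_upwards [hF.start, hh] with z hz hz'
    rw [hz, hz']
  analyticAt t := (hg t).comp (hF.analyticAt t)
  coherent t := by
    filter_upwards [hF.coherent t] with s hs
    filter_upwards [hs] with z hz
    rw [hz]

theorem exists_norm_apply_lt {R : ℝ} (hF : IsContinuationAlong γ f F)
    (hR : ∀ t, ‖F t (γ t)‖ < R) : ∃ ρ, 0 < ρ ∧ ρ < R ∧ ∀ t, ‖F t (γ t)‖ < ρ := by
  obtain ⟨tmax, -, hmax⟩ := isCompact_univ.exists_isMaxOn Set.univ_nonempty
    hF.continuous_apply.norm.continuousOn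
  obtain ⟨ρ, hρmax, hρR⟩ := exists_between (hR tmax)
  exact ⟨ρ, (norm_nonneg _).trans_lt hρmax, hρR,
    fun t => (hmax (Set.mem_univ t)).trans_lt hρmax⟩

end IsContinuationAlong

/-! ### Convergence along curves -/

/-- The map `g` with `psiComp n = g ∘ nome` near `0`, where `e` is the function of
`exists_psiComp_eq_nome_mul_exp`. -/
def nomeToPsiComp (e : ℂ → ℂ) (n : ℕ) (q : ℂ) : ℂ :=
  q * Complex.exp (e (q ^ 2 ^ n) / 2 ^ n)

theorem norm_pow_two_pow_le {q : ℂ} (hq : ‖q‖ ≤ 1) (n : ℕ) : ‖q ^ 2 ^ n‖ ≤ ‖q‖ := by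
  rw [norm_pow]
  exact pow_le_of_le_one (norm_nonneg _) hq (by positivity)

theorem differentiableOn_nomeToPsiComp {e : ℂ → ℂ} {ρ : ℝ} (hρ : ρ ≤ 1)
    (he : DifferentiableOn ℂ e (Metric.ball 0 ρ)) (n : ℕ) :
    DifferentiableOn ℂ (nomeToPsiComp e n) (Metric.ball 0 ρ) := by
  have hpow : Set.MapsTo (fun q : ℂ => q ^ 2 ^ n) (Metric.ball 0 ρ) (Metric.ball 0 ρ) := by
    intro q hq
    rw [mem_ball_zero_iff] at hq ⊢
    exact (norm_pow_two_pow_le (hq.le.trans hρ) n).trans_lt hq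
  have hcomp := he.comp (f := fun q : ℂ => q ^ 2 ^ n) (by fun_prop) hpow
  exact differentiableOn_id.mul (hcomp.div_const _).cexp

theorem norm_mul_exp_sub_self_le {q u : ℂ} (hq : ‖q‖ ≤ 1) (hu : ‖u‖ ≤ 1) :
    ‖q * Complex.exp u - q‖ ≤ 2 * ‖u‖ :=
  calc ‖q * Complex.exp u - q‖ = ‖q‖ * ‖Complex.exp u - 1‖ := by rw [← norm_mul, mul_sub_one]
    _ ≤ 1 * (2 * ‖u‖) :=
      mul_le_mul hq (Complex.norm_exp_sub_one_le hu) (norm_nonneg _) zero_le_one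
    _ = 2 * ‖u‖ := one_mul _

theorem tendstoUniformlyOn_nomeToPsiComp {e : ℂ → ℂ} {ρ : ℝ} (hρ : ρ ≤ 1)
    (he : ContinuousOn e (Metric.closedBall 0 ρ)) :
    TendstoUniformlyOn (nomeToPsiComp e) id atTop (Metric.closedBall 0 ρ) := by
  obtain ⟨C, hC⟩ := (isCompact_closedBall (0 : ℂ) ρ).exists_bound_of_continuousOn he
  have hlim : Tendsto (fun n : ℕ => C / (2 : ℝ) ^ n) atTop (𝓝 0) :=
    tendsto_const_nhds.div_atTop (tendsto_pow_atTop_atTop_of_one_lt one_lt_two)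
  rw [Metric.tendstoUniformlyOn_iff]
  intro ε hε
  filter_upwards [hlim.eventually_lt_const (half_pos hε),
    hlim.eventually_lt_const one_pos] with n hnε hn1 q hq
  have hqρ : ‖q‖ ≤ ρ := mem_closedBall_zero_iff.1 hq
  have hqn : ‖q ^ 2 ^ n‖ ≤ ρ := (norm_pow_two_pow_le (hqρ.trans hρ) n).trans hqρ
  have hbound : ‖e (q ^ 2 ^ n) / 2 ^ n‖ ≤ C / (2 : ℝ) ^ n := by
    rw [norm_div, norm_pow, Complex.norm_ofNat]
    gcongr
    exact hC _ (mem_closedBall_zero_iff.2 hqn)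
  rw [dist_comm, dist_eq_norm]
  calc ‖nomeToPsiComp e n q - q‖ ≤ 2 * ‖e (q ^ 2 ^ n) / 2 ^ n‖ :=
        norm_mul_exp_sub_self_le (hqρ.trans hρ) (hbound.trans hn1.le)
    _ < ε := by linarith

theorem exists_ball_tendstoUniformlyOn_nomeToPsiComp {e Q : ℂ → ℂ} {ρ : ℝ} {p : ℂ} (hρ : ρ ≤ 1)
    (he : DifferentiableOn ℂ e (Metric.ball 0 ρ)) (hQ : AnalyticAt ℂ Q p) (hQp : ‖Q p‖ < ρ) :
    ∃ r : ℝ, 0 < r ∧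
      (∀ n, DifferentiableOn ℂ (fun z => nomeToPsiComp e n (Q z)) (Metric.ball p r)) ∧
      DifferentiableOn ℂ Q (Metric.ball p r) ∧
      TendstoUniformlyOn (fun n z => nomeToPsiComp e n (Q z)) Q atTop (Metric.ball p r) := by
  obtain ⟨ρ', hQρ', hρ'⟩ := exists_between hQp
  obtain ⟨r, hr, hball⟩ := Metric.mem_nhds_iff.1
    (hQ.eventually_analyticAt.and (hQ.continuousAt.norm.eventually_lt_const hQρ'))
  have hQd : DifferentiableOn ℂ Q (Metric.ball p r) := fun z hz =>
    (hball hz).1.differentiableAt.differentiableWithinAt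
  refine ⟨r, hr, fun n => (differentiableOn_nomeToPsiComp hρ he n).comp hQd fun z hz =>
    mem_ball_zero_iff.2 ((hball hz).2.trans hρ'), hQd, ?_⟩
  have hunif := tendstoUniformlyOn_nomeToPsiComp (hρ'.le.trans hρ)
    (he.continuousOn.mono (Metric.closedBall_subset_ball hρ'))
  exact (hunif.comp Q).mono fun z hz => mem_closedBall_zero_iff.2 (hball hz).2.le

end

end NomeComposition

theorem theorem2 :
    -- first sheet, principal branches
    TendstoLocallyUniformlyOn NomeComposition.psiComp NomeComposition.nome Filter.atTop
      NomeComposition.oneCutPlane ∧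
    -- all sheets of the covering with fixed origin, by continuation along curves
    ∀ γ : C(unitInterval, ℂ), NomeComposition.IsCurveFromOrigin γ →
      ∃ (F : ℕ → unitInterval → ℂ → ℂ) (Q : unitInterval → ℂ → ℂ),
        (∀ n, NomeComposition.IsContinuationAlong γ (NomeComposition.psiComp n) (F n)) ∧
        NomeComposition.IsContinuationAlong γ NomeComposition.nome Q ∧
        ∀ t, ∃ r : ℝ, 0 < r ∧
          (∀ n, DifferentiableOn ℂ (F n t) (Metric.ball (γ t) r)) ∧
          DifferentiableOn ℂ (Q t) (Metric.ball (γ t) r) ∧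
          TendstoUniformlyOn (fun n => F n t) (Q t) Filter.atTop (Metric.ball (γ t) r) := by
  refine ⟨NomeComposition.tendstoUniformlyOn_psiComp_nome.tendstoLocallyUniformlyOn,
    fun γ hγ => ?_⟩
  obtain ⟨Q, hQ, hQ1⟩ := NomeComposition.exists_isContinuationAlong_nome hγ
  obtain ⟨ρ, hρ0, hρ1, hQρ⟩ := hQ.exists_norm_apply_lt hQ1
  obtain ⟨e, hed, he⟩ := NomeComposition.exists_psiComp_eq_nome_mul_exp hρ0 hρ1
  refine ⟨fun n t z => NomeComposition.nomeToPsiComp e n (Q t z), Q,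
    fun n => hQ.comp_left (fun t => ?_) (hγ.1.symm ▸ he n), hQ, fun t =>
    NomeComposition.exists_ball_tendstoUniformlyOn_nomeToPsiComp hρ1.le hed (hQ.analyticAt t)
      (hQρ t)⟩
  exact (NomeComposition.differentiableOn_nomeToPsiComp hρ1.le hed n).analyticAt
    (Metric.isOpen_ball.mem_nhds (mem_ball_zero_iff.2 (hQρ t)))
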